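/- Let $\rho>0$. Throughout, $\circ$ is the entrywise (Hadamard) product, $\|\cdot\|$ the Euclidean norm, $\log$ the natural logarithm, and complex processes have finite second moments and are (wide-sense) stationary. A binary vector is a vector with entries in $\{0,1\}$; all binary vectors below are nonzero. **One dimension.** Let $\{X[k]\}_{k\in\mathbb Z}$ be a stationary complex random process with correlation function $r[k]=\mathbb E\big[X[k'+k]\,\overline{X[k']}\big]$ and spectral density $S(\theta)=\sum_{k\in\mathbb Z} r[k]e^{-2\pi i k\theta}$, $|\theta|\le 1/2$; that is, $S$ is real-valued and integrable on $[-1/2,1/2]$ and the series is its Fourier series: $r[k]=\int_{-1/2}^{1/2}S(\theta)e^{2\pi i k\theta}\,d\theta$ for all $k$. (If $\sum_k|r[k]|<\infty$, this holds for the sum $S$ of the series.) For $N\ge 1$ let $\mathbf X=(X[0],\dots,X[N-1])^{T}$ and $K_N=\mathbb E[\mathbf X\mathbf X^{H}]$. Then: 1. $S\ge 0$ almost everywhere and $\log(1+\rho S)$ is integrable on $[-1/2,1/2]$. 2. For every $N\ge1$, $K_N$ is Hermitian Toeplitz with $[K_N]_{i,j}=r[i-j]$. For every nonzero binary $x\in\{0,1\}^N$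 the matrix $I_N+\rho(xx^{H})\circ K_N$ is positive definite and $$\frac1{\|x\|^2}\log\det\big(I_N+\rho\,(xx^{H})\circ K_N\big)\ \ge\ \int_{-1/2}^{1/2}\log\big(1+\rho S(\theta)\big)\,d\theta ,$$ so that the infimum of the left-hand side over nonzero binary $x\in\{0,1\}^N$ is also at least the right-hand side. 3. For the all-ones vector there is equality in the limit: $$\lim_{N\to\infty}\frac1N\log\det(I_N+\rho K_N)=\int_{-1/2}^{1/2}\log\big(1+\rho S(\theta)\big)\,d\theta .$$ **Two dimensions.** Let $\{X[k,n]\}_{(k,n)\in\mathbb Z^2}$ be a complex random process that is stationary in $(k,n)$, with correlation function $r[k,n]=\mathbb E\big[X[k+k',n+n']\,\overline{X[k',n']}\big]$ and two-dimensional spectral density $S(\theta,\varphi)=\sum_{k,n}r[k,n]e^{-2\pi i(k\theta-n\varphi)}$, $|\theta|,|\varphi|\le 1/2$; that is, $S$ is real-valued and integrable on $[-1/2,1/2]^2$ and $r[k,n]=\iint_{[-1/2,1/2]^2}S(\theta,\varphi)e^{2\pi i(k\theta-n\varphi)}\,d\theta\,d\varphi$ for all $k,n$. (If $\sum_{k,n}|r[k,n]|<\infty$,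 this holds for the sum $S$ of the series.) For $N,F\ge1$ let $\mathbf X$ be the $NF$-dimensional vector obtained by stacking the blocks $(X[k,0],\dots,X[k,F-1])^{T}$, $k=0,\dots,N-1$, and let $K_{N,F}=\mathbb E[\mathbf X\mathbf X^{H}]$. Then: 1. $S\ge 0$ almost everywhere and $\log(1+\rho S)$ is integrable on $[-1/2,1/2]^2$. 2. For all $N,F\ge1$, $K_{N,F}$ is Hermitian and two-level Toeplitz: its entry at position $(a,b)$ of block $(i,j)$ is $r[i-j,a-b]$. For every nonzero binary $x\in\{0,1\}^{NF}$ the matrix $I_{NF}+\rho(xx^{H})\circ K_{N,F}$ is positive definite and $$\frac1{\|x\|^2}\log\det\big(I_{NF}+\rho\,(xx^{H})\circ K_{N,F}\big)\ \ge\ \int_{-1/2}^{1/2}\int_{-1/2}^{1/2}\log\big(1+\rho S(\theta,\varphi)\big)\,d\theta\,d\varphi ,$$ so that the infimum of the left-hand side over nonzero binary $x$ is also at least the right-hand side. 3. For the all-ones vector there is equality in the limit when $N$ and $F$ tend to infinity (independently of each other): $$\lim_{N,F\to\infty}\frac1{NF}\log\det(I_{NF}+\rho K_{N,F})=\int_{-1/2}^{1/2}\int_{-1/2}^{1/2}\log\big(1+\rho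 S(\theta,\varphi)\big)\,d\theta\,d\varphi .$$ -/

import Mathlib

open MeasureTheory Filter Topology
open scoped Matrix ComplexConjugate ComplexOrder

noncomputable section

namespace StationaryLogDet

/-- Autocorrelation function `r[n] = E[X[n] * conj X[0]]` of a complex process indexed by `G`. -/
def corr {G Ω : Type*} [AddCommGroup G] [MeasurableSpace Ω] (μ : Measure Ω)
    (X : G → Ω → ℂ) (n : G) : ℂ :=
  ∫ ω, X n ω * conj (X 0 ω) ∂μ

/-- (Wide-sense) stationarity of a complex second-order process: constant mean, and
`E[X[m + n] * conj X[m]]` does not depend on `m`.  Every strictly stationary process with finite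
second moments has this property. -/
structure IsStationary {G Ω : Type*} [AddCommGroup G] [MeasurableSpace Ω] (μ : Measure Ω)
    (X : G → Ω → ℂ) : Prop where
  memLp : ∀ n, MemLp (X n) 2 μ
  mean_eq : ∀ n, ∫ ω, X n ω ∂μ = ∫ ω, X 0 ω ∂μ
  corr_eq : ∀ n m, ∫ ω, X (m + n) ω * conj (X m ω) ∂μ = corr μ X n

/-- The matrix `E[v vᴴ]` of a random vector `v`. -/
def covMatrix {ι Ω : Type*} [MeasurableSpace Ω] (μ : Measure Ω) (v : ι → Ω → ℂ) :
    Matrix ι ι ℂ :=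
  Matrix.of fun i j => ∫ ω, v i ω * conj (v j ω) ∂μ

/-- The vector `(X[0], …, X[N-1])`. -/
def window {Ω : Type*} (X : ℤ → Ω → ℂ) (N : ℕ) : Fin N → Ω → ℂ :=
  fun i => X (i : ℕ)

/-- The stacked vector of the `X[k, n]`, `0 ≤ k < N`, `0 ≤ n < F`; the index pair `(k, n)` is
position `n` of block `k`. -/
def window₂ {Ω : Type*} (X : ℤ × ℤ → Ω → ℂ) (N F : ℕ) : Fin N × Fin F → Ω → ℂ :=
  fun p => X ((p.1 : ℕ), (p.2 : ℕ))

/-- `S` is the spectral density belonging to the correlation sequence `r`: `S` is integrable on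
`[-1/2, 1/2]` and `∑ r[n] exp(-2πi n θ)` is its Fourier series.  No mode of pointwise convergence
of the series is imposed, so that discontinuous or unbounded densities are included; for absolutely
summable `r`, see `isSpectralDensity_of_hasSum`. -/
structure IsSpectralDensity (r : ℤ → ℂ) (S : ℝ → ℝ) : Prop where
  integrable : IntervalIntegrable S volume (-(1 / 2)) (1 / 2)
  coeff : ∀ n : ℤ, r n =
    ∫ θ in (-(1 / 2) : ℝ)..(1 / 2), (S θ : ℂ) * Complex.exp (2 * Real.pi * Complex.I * (n * θ))

/-- The square `[-1/2, 1/2]²`. -/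
def square : Set (ℝ × ℝ) :=
  Set.Icc (-(1 / 2)) (1 / 2) ×ˢ Set.Icc (-(1 / 2)) (1 / 2)

/-- Two-dimensional spectral density: `S` is integrable on the square and
`∑ r[k, n] exp(-2πi (k θ - n φ))` is its Fourier series. -/
structure IsSpectralDensity₂ (r : ℤ × ℤ → ℂ) (S : ℝ → ℝ → ℝ) : Prop where
  integrable : IntegrableOn (fun p : ℝ × ℝ => S p.1 p.2) square
  coeff : ∀ k n : ℤ, r (k, n) =
    ∫ p in square,
      (S p.1 p.2 : ℂ) * Complex.exp (2 * Real.pi * Complex.I * (k * p.1 - n * p.2))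

/-- The matrix `I + ρ (x xᴴ) ∘ K`, where `∘` is the entrywise product. -/
def maskedMatrix {ι : Type*} [Fintype ι] [DecidableEq ι] (ρ : ℝ) (K : Matrix ι ι ℂ)
    (x : EuclideanSpace ℂ ι) : Matrix ι ι ℂ :=
  1 + (ρ : ℂ) • (Matrix.vecMulVec x.ofLp (star x.ofLp) ⊙ K)

/-- `(1 / ‖x‖²) log det (I + ρ (x xᴴ) ∘ K)` with the Euclidean norm. -/
def normLogDet {ι : Type*} [Fintype ι] [DecidableEq ι] (ρ : ℝ) (K : Matrix ι ι ℂ)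
    (x : EuclideanSpace ℂ ι) : ℝ :=
  1 / ‖x‖ ^ 2 * Real.log (maskedMatrix ρ K x).det.re

/-- Vectors with entries in `{0, 1}`, not all of them `0`. -/
def BinaryVec (ι : Type*) : Type _ :=
  {x : EuclideanSpace ℂ ι // (∀ i, x i = 0 ∨ x i = 1) ∧ x ≠ 0}

/-- The all-ones vector. -/
def ones (ι : Type*) : EuclideanSpace ℂ ι := WithLp.toLp 2 fun _ => 1

theorem integral_exp_int (m : ℤ) :
    ∫ θ in Set.Icc (-(1 / 2) : ℝ) (1 / 2), Complex.exp (2 * Real.pi * Complex.I * (m * θ)) =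
      if m = 0 then 1 else 0 := by
  rw [integral_Icc_eq_integral_Ioc,
    ← intervalIntegral.integral_of_le (by norm_num : (-(1 / 2) : ℝ) ≤ 1 / 2)]
  split_ifs with h
  · subst h; norm_num
  · have hc : (2 * Real.pi * Complex.I * m : ℂ) ≠ 0 := by
      simp [Real.pi_ne_zero, h]
    have := integral_exp_mul_complex (a := -(1 / 2)) (b := 1 / 2) hc
    simp only [mul_assoc] at this ⊢
    rw [this, div_eq_zero_iff]
    left
    rw [sub_eq_zero, Complex.exp_eq_exp_iff_exists_int]
    exact ⟨m, by push_cast; ring⟩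

theorem norm_exp_two_pi (t : ℝ) : ‖Complex.exp (2 * Real.pi * Complex.I * t)‖ = 1 := by
  have : (2 * Real.pi * Complex.I * t : ℂ) = ((2 * Real.pi * t : ℝ) : ℂ) * Complex.I := by
    push_cast; ring
  rw [this, Complex.norm_exp_ofReal_mul_I]

/-- If `r` is absolutely summable, the sum of the series `∑ r[n] exp(-2πi n θ)` is the spectral
density. -/
theorem isSpectralDensity_of_hasSum (r : ℤ → ℂ) (S : ℝ → ℝ) (hr : Summable fun n => ‖r n‖)
    (hS : ∀ θ : ℝ, HasSum (fun n : ℤ => r n * Complex.exp (-(2 * Real.pi * Complex.I * (n * θ))))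
      (S θ : ℂ)) : IsSpectralDensity r S := by
  have hnorm : ∀ (n : ℤ) (θ : ℝ),
      ‖r n * Complex.exp (-(2 * Real.pi * Complex.I * (n * θ)))‖ ≤ ‖r n‖ := by
    intro n θ
    have := norm_exp_two_pi (-(n * θ))
    push_cast at this
    rw [mul_neg] at this
    rw [norm_mul, this, mul_one]
  have hcont : Continuous S := by
    have h : Continuous fun θ : ℝ =>
        ∑' n : ℤ, r n * Complex.exp (-(2 * Real.pi * Complex.I * (n * θ))) :=
      continuous_tsum (fun n => by fun_prop) hr hnorm
    have h2 : S = fun θ : ℝ =>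
        (∑' n : ℤ, r n * Complex.exp (-(2 * Real.pi * Complex.I * (n * θ)))).re := by
      funext θ; rw [(hS θ).tsum_eq, Complex.ofReal_re]
    rw [h2]; exact Complex.continuous_re.comp h
  refine ⟨hcont.intervalIntegrable _ _, fun n => ?_⟩
  rw [intervalIntegral.integral_of_le (by norm_num : (-(1 / 2) : ℝ) ≤ 1 / 2),
    ← integral_Icc_eq_integral_Ioc]
  set f : ℤ → ℝ → ℂ := fun m θ => r m * Complex.exp (2 * Real.pi * Complex.I * ((n - m : ℤ) * θ))
    with hf
  have hfS : ∀ θ : ℝ, HasSum (fun m => f m θ)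
      ((S θ : ℂ) * Complex.exp (2 * Real.pi * Complex.I * (n * θ))) := by
    intro θ
    refine ((hS θ).mul_right _).congr_fun ?_
    intro m
    simp only [hf]
    rw [mul_assoc (r m), ← Complex.exp_add]
    congr 2; push_cast; ring
  have hfn : ∀ m (θ : ℝ), ‖f m θ‖ = ‖r m‖ := by
    intro m θ
    have := norm_exp_two_pi ((n - m : ℤ) * θ)
    rw [Complex.ofReal_mul, Complex.ofReal_intCast] at this
    simp only [hf]
    rw [norm_mul, this, mul_one]
  have key := hasSum_integral_of_summable_integral_norm
    (μ := volume.restrict (Set.Icc (-(1 / 2) : ℝ) (1 / 2))) (F := f)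
    (fun m => (Continuous.continuousOn (by fun_prop)).integrableOn_Icc)
    (by simp only [hfn]; norm_num [hr])
  simp only [(hfS _).tsum_eq] at key
  rw [← key.tsum_eq, tsum_eq_single n]
  · simp only [hf, integral_const_mul, integral_exp_int]; simp
  · intro m hm
    simp only [hf, integral_const_mul, integral_exp_int]
    rw [if_neg (sub_ne_zero.mpr hm.symm), mul_zero]

/-- If `r` is absolutely summable, the sum of the series `∑ r[k, n] exp(-2πi (k θ - n φ))` is the
two-dimensional spectral density. -/
theorem isSpectralDensity₂_of_hasSum (r : ℤ × ℤ → ℂ) (S : ℝ → ℝ → ℝ)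
    (hr : Summable fun n => ‖r n‖)
    (hS : ∀ θ φ : ℝ, HasSum (fun n : ℤ × ℤ =>
      r n * Complex.exp (-(2 * Real.pi * Complex.I * (n.1 * θ - n.2 * φ)))) (S θ φ : ℂ)) :
    IsSpectralDensity₂ r S := by
  have hnorm : ∀ (n : ℤ × ℤ) (p : ℝ × ℝ),
      ‖r n * Complex.exp (-(2 * Real.pi * Complex.I * (n.1 * p.1 - n.2 * p.2)))‖ ≤ ‖r n‖ := by
    intro n p
    have := norm_exp_two_pi (-(n.1 * p.1 - n.2 * p.2))
    push_cast at this
    rw [mul_neg] at this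
    rw [norm_mul, this, mul_one]
  have hcont : Continuous fun p : ℝ × ℝ => S p.1 p.2 := by
    have h : Continuous fun p : ℝ × ℝ => ∑' n : ℤ × ℤ,
        r n * Complex.exp (-(2 * Real.pi * Complex.I * (n.1 * p.1 - n.2 * p.2))) :=
      continuous_tsum (fun n => by fun_prop) hr hnorm
    have h2 : (fun p : ℝ × ℝ => S p.1 p.2) = fun p : ℝ × ℝ => (∑' n : ℤ × ℤ,
        r n * Complex.exp (-(2 * Real.pi * Complex.I * (n.1 * p.1 - n.2 * p.2)))).re := by
      funext p; rw [(hS p.1 p.2).tsum_eq, Complex.ofReal_re]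
    rw [h2]; exact Complex.continuous_re.comp h
  have hK : IsCompact square := isCompact_Icc.prod isCompact_Icc
  have hvol : volume.real square = 1 := by
    rw [square, Measure.volume_eq_prod, measureReal_prod_prod]; norm_num
  refine ⟨hcont.continuousOn.integrableOn_compact hK, fun a b => ?_⟩
  set f : ℤ × ℤ → ℝ × ℝ → ℂ := fun m p => r m *
    (Complex.exp (2 * Real.pi * Complex.I * ((a - m.1 : ℤ) * p.1)) *
      Complex.exp (2 * Real.pi * Complex.I * ((m.2 - b : ℤ) * p.2))) with hf
  have hfS : ∀ p : ℝ × ℝ, HasSum (fun m => f m p)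
      ((S p.1 p.2 : ℂ) * Complex.exp (2 * Real.pi * Complex.I * (a * p.1 - b * p.2))) := by
    intro p
    refine ((hS p.1 p.2).mul_right _).congr_fun ?_
    intro m
    simp only [hf]
    rw [mul_assoc (r m), ← Complex.exp_add, ← Complex.exp_add]
    congr 2; push_cast; ring
  have hfn : ∀ m (p : ℝ × ℝ), ‖f m p‖ = ‖r m‖ := by
    intro m p
    have h1 := norm_exp_two_pi ((a - m.1 : ℤ) * p.1)
    have h2 := norm_exp_two_pi ((m.2 - b : ℤ) * p.2)
    rw [Complex.ofReal_mul, Complex.ofReal_intCast] at h1 h2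
    simp only [hf]
    rw [norm_mul, norm_mul, h1, h2, mul_one, mul_one]
  have hint : ∀ m : ℤ × ℤ, ∫ p in square, f m p =
      r m * ((if a - m.1 = 0 then 1 else 0) * (if m.2 - b = 0 then 1 else 0)) := by
    intro m
    simp only [hf, integral_const_mul]
    rw [square, Measure.volume_eq_prod, setIntegral_prod_mul
      (fun x : ℝ => Complex.exp (2 * Real.pi * Complex.I * ((a - m.1 : ℤ) * x)))
      (fun y : ℝ => Complex.exp (2 * Real.pi * Complex.I * ((m.2 - b : ℤ) * y))),
      integral_exp_int, integral_exp_int]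
  have key := hasSum_integral_of_summable_integral_norm
    (μ := volume.restrict square) (F := f)
    (fun m => (Continuous.continuousOn (by fun_prop)).integrableOn_compact hK)
    (by simp only [hfn]; simp [hvol, hr])
  simp only [(hfS _).tsum_eq] at key
  rw [← key.tsum_eq, tsum_eq_single (a, b)]
  · simp [hint]
  · intro m hm
    rw [hint]
    by_cases h1 : a - m.1 = 0
    · by_cases h2 : m.2 - b = 0
      · exact absurd (Prod.ext (by simp; omega) (by simp; omega)) hm
      · simp [h2]
    · simp [h1]

end StationaryLogDet

end

noncomputable section

set_option linter.unusedSectionVars false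

namespace StationaryLogDet

/-- A family of unimodular functions indexed by a group which multiply like characters, are
orthonormal, and whose linear combinations are dense in `L¹`. -/
structure IsCharacterSystem {G T : Type*} [AddCommGroup G] [MeasurableSpace T] (ν : Measure T)
    (χ : G → T → ℂ) : Prop where
  measurable : ∀ g, Measurable (χ g)
  norm_eq_one : ∀ g t, ‖χ g t‖ = 1
  sub : ∀ g h t, χ (g - h) t = χ g t * conj (χ h t)
  integral_eq_zero : ∀ g, g ≠ 0 → ∫ t, χ g t ∂ν = 0
  dense : ∀ f : T → ℂ, Integrable f ν → ∀ ε > 0,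
    ∃ P ∈ Submodule.span ℂ (Set.range χ), ∫ t, ‖f t - P t‖ ∂ν ≤ ε

/-- The character polynomial `∑ conj (c i) χ (g i)`. -/
def charSum {G T ι : Type*} [Fintype ι] (χ : G → T → ℂ) (g : ι → G) (c : ι → ℂ) (t : T) : ℂ :=
  ∑ i, conj (c i) * χ (g i) t

section CharSum

variable {G T ι : Type*} [AddCommGroup G] [MeasurableSpace T] {ν : Measure T}
  [IsProbabilityMeasure ν] {χ : G → T → ℂ} [Fintype ι]

theorem IsCharacterSystem.zero (hχ : IsCharacterSystem ν χ) (t : T) : χ 0 t = 1 := by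
  have h := hχ.sub 0 0 t
  rw [sub_zero, Complex.mul_conj, Complex.normSq_eq_norm_sq, hχ.norm_eq_one] at h
  simpa using h

theorem IsCharacterSystem.integral (hχ : IsCharacterSystem ν χ) [DecidableEq G] (g : G) :
    ∫ t, χ g t ∂ν = if g = 0 then 1 else 0 := by
  split_ifs with h
  · subst h; simp [hχ.zero]
  · exact hχ.integral_eq_zero g h

theorem IsCharacterSystem.measurable_charSum (hχ : IsCharacterSystem ν χ) (g : ι → G)
    (c : ι → ℂ) : Measurable (charSum χ g c) :=
  Finset.measurable_fun_sum _ fun i _ => (hχ.measurable (g i)).const_mul _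

theorem IsCharacterSystem.norm_charSum_le (hχ : IsCharacterSystem ν χ) (g : ι → G)
    (c : ι → ℂ) (t : T) : ‖charSum χ g c t‖ ≤ ∑ i, ‖c i‖ := by
  refine (norm_sum_le _ _).trans (Finset.sum_le_sum fun i _ => ?_)
  simp [hχ.norm_eq_one]

theorem IsCharacterSystem.integrable_mul_charSum (hχ : IsCharacterSystem ν χ) (g : ι → G)
    (c : ι → ℂ) {f : T → ℝ} (hf : Integrable f ν) :
    Integrable (fun t => f t * ‖charSum χ g c t‖ ^ 2) ν := by
  refine hf.mul_bdd (c := (∑ i, ‖c i‖) ^ 2)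
    ((hχ.measurable_charSum g c).norm.pow_const 2).aestronglyMeasurable
    (ae_of_all _ fun t => ?_)
  rw [Real.norm_of_nonneg (by positivity)]
  exact pow_le_pow_left₀ (norm_nonneg _) (hχ.norm_charSum_le g c t) 2

theorem IsCharacterSystem.integrable_sq_charSum (hχ : IsCharacterSystem ν χ) (g : ι → G)
    (c : ι → ℂ) : Integrable (fun t => ‖charSum χ g c t‖ ^ 2) ν := by
  simpa using hχ.integrable_mul_charSum g c (integrable_const (1 : ℝ))

theorem IsCharacterSystem.integrable_mul_char (hχ : IsCharacterSystem ν χ) (g : G)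
    {f : T → ℂ} (hf : Integrable f ν) : Integrable (fun t => f t * χ g t) ν :=
  hf.mul_bdd (c := 1) (hχ.measurable g).aestronglyMeasurable
    (ae_of_all _ fun t => (hχ.norm_eq_one g t).le)

theorem IsCharacterSystem.sq_charSum (hχ : IsCharacterSystem ν χ) (g : ι → G)
    (c : ι → ℂ) (t : T) : ((‖charSum χ g c t‖ ^ 2 : ℝ) : ℂ) =
      ∑ i, ∑ j, conj (c i) * c j * χ (g i - g j) t := by
  rw [← Complex.normSq_eq_norm_sq, ← Complex.mul_conj, charSum, map_sum, Finset.sum_mul_sum]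
  refine Finset.sum_congr rfl fun i _ => Finset.sum_congr rfl fun j _ => ?_
  rw [hχ.sub, map_mul, Complex.conj_conj]; ring

/-- The quadratic form of a Toeplitz matrix in terms of its symbol. -/
theorem IsCharacterSystem.integral_mul_sq_charSum (hχ : IsCharacterSystem ν χ) {f : T → ℝ}
    (hf : Integrable f ν) {r : G → ℂ} (hr : ∀ g, r g = ∫ t, (f t : ℂ) * χ g t ∂ν)
    (g : ι → G) (c : ι → ℂ) :
    ((∫ t, f t * ‖charSum χ g c t‖ ^ 2 ∂ν : ℝ) : ℂ) =
      ∑ i, ∑ j, conj (c i) * c j * r (g i - g j) := by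
  have hi : ∀ i j : ι, Integrable
      (fun t => conj (c i) * c j * ((f t : ℂ) * χ (g i - g j) t)) ν := fun i j =>
    (hχ.integrable_mul_char _ hf.ofReal).const_mul _
  calc _ = ∫ t, ∑ i, ∑ j, conj (c i) * c j * ((f t : ℂ) * χ (g i - g j) t) ∂ν := by
        rw [← integral_complex_ofReal]
        refine integral_congr_ae (ae_of_all _ fun t => ?_)
        simp only
        rw [Complex.ofReal_mul, hχ.sq_charSum, Finset.mul_sum]
        refine Finset.sum_congr rfl fun i _ => ?_
        rw [Finset.mul_sum]
        refine Finset.sum_congr rfl fun j _ => ?_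
        ring
    _ = _ := by
        rw [integral_finsetSum _ fun i _ => integrable_finsetSum _ fun j _ => hi i j]
        refine Finset.sum_congr rfl fun i _ => ?_
        rw [integral_finsetSum _ fun j _ => hi i j]
        refine Finset.sum_congr rfl fun j _ => ?_
        rw [integral_const_mul, hr]

/-- Parseval's identity for character polynomials with distinct characters. -/
theorem IsCharacterSystem.integral_sq_charSum (hχ : IsCharacterSystem ν χ)
    {g : ι → G} (hg : Function.Injective g) (c : ι → ℂ) :
    ∫ t, ‖charSum χ g c t‖ ^ 2 ∂ν = ∑ i, ‖c i‖ ^ 2 := by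
  classical
  have h := hχ.integral_mul_sq_charSum (f := fun _ => 1) (integrable_const _)
    (r := fun g => if g = 0 then 1 else 0) (fun g => by simp [hχ.integral]) g c
  simp only [one_mul, sub_eq_zero, hg.eq_iff, mul_ite, mul_one, mul_zero, Finset.sum_ite_eq,
    Finset.mem_univ, if_true] at h
  apply Complex.ofReal_injective
  rw [h, Complex.ofReal_sum]
  refine Finset.sum_congr rfl fun i _ => ?_
  rw [mul_comm, Complex.mul_conj, Complex.normSq_eq_norm_sq]

end CharSum

section Spectral

variable {ι : Type*} [Fintype ι] [DecidableEq ι] {M : Matrix ι ι ℂ}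

theorem log_det_eq_sum (hM : M.PosDef) :
    Real.log M.det.re = ∑ k, Real.log (hM.isHermitian.eigenvalues k) := by
  rw [hM.isHermitian.det_eq_prod_eigenvalues]
  rw [← Real.log_prod fun k _ => (hM.eigenvalues_pos k).ne']
  congr 1
  exact_mod_cast Complex.ofReal_re _

theorem eigenvalues_eq_sum (hM : M.IsHermitian) (k : ι) :
    (hM.eigenvalues k : ℂ) = ∑ i, ∑ j,
      conj (hM.eigenvectorBasis k i) * hM.eigenvectorBasis k j * M i j := by
  have h1 : star (hM.eigenvectorBasis k).ofLp ⬝ᵥ M *ᵥ (hM.eigenvectorBasis k).ofLp =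
      (hM.eigenvalues k : ℂ) := by
    rw [hM.mulVec_eigenvectorBasis, dotProduct_smul, dotProduct_comm,
      ← EuclideanSpace.inner_eq_star_dotProduct]
    simp [inner_self_eq_norm_sq_to_K]
  rw [← h1]
  simp only [dotProduct, Matrix.mulVec, Finset.mul_sum, Pi.star_apply, RCLike.star_def]
  refine Finset.sum_congr rfl fun i _ => Finset.sum_congr rfl fun j _ => ?_
  ring

theorem sum_mul_eq_sum_eigenvalues (hM : M.IsHermitian) (v : EuclideanSpace ℂ ι) :
    ∑ i, ∑ j, conj (v i) * v j * M i j =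
      ((∑ k, ‖inner ℂ (hM.eigenvectorBasis k) v‖ ^ 2 * hM.eigenvalues k : ℝ) : ℂ) := by
  set b := hM.eigenvectorBasis
  have h1 : inner ℂ v (WithLp.toLp 2 (M *ᵥ v.ofLp)) =
      ∑ i, ∑ j, conj (v i) * v j * M i j := by
    rw [EuclideanSpace.inner_eq_star_dotProduct, dotProduct_comm]
    simp only [dotProduct, Matrix.mulVec, Finset.mul_sum, Pi.star_apply, RCLike.star_def]
    refine Finset.sum_congr rfl fun i _ => Finset.sum_congr rfl fun j _ => ?_
    ring
  rw [← h1, ← b.sum_inner_mul_inner, Complex.ofReal_sum]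
  refine Finset.sum_congr rfl fun k _ => ?_
  have h2 : inner ℂ (b k) (WithLp.toLp 2 (M *ᵥ v.ofLp)) =
      hM.eigenvalues k * inner ℂ (b k) v := by
    have h3 : star (b k).ofLp ᵥ* M = (hM.eigenvalues k : ℂ) • star (b k).ofLp := by
      have := congrArg star (hM.mulVec_eigenvectorBasis k)
      rw [Matrix.star_mulVec, hM.eq] at this
      rw [this]
      ext i; simp [b]
    rw [EuclideanSpace.inner_eq_star_dotProduct, EuclideanSpace.inner_eq_star_dotProduct,
      dotProduct_comm, Matrix.dotProduct_mulVec, h3, smul_dotProduct, dotProduct_comm]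
    simp
  rw [h2, mul_left_comm, ← inner_conj_symm v (b k), ← mul_comm (inner ℂ (b k) v),
    Complex.mul_conj, Complex.normSq_eq_norm_sq]
  push_cast; ring

/-- Jensen's inequality for the spectral measure of a unit vector. -/
theorem sum_log_eigenvalues_le (hM : M.PosDef) {v : EuclideanSpace ℂ ι} (hv : ‖v‖ = 1) :
    ∑ k, ‖inner ℂ (hM.isHermitian.eigenvectorBasis k) v‖ ^ 2 *
        Real.log (hM.isHermitian.eigenvalues k) ≤
      Real.log (∑ i, ∑ j, conj (v i) * v j * M i j).re := by
  rw [sum_mul_eq_sum_eigenvalues hM.isHermitian, Complex.ofReal_re]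
  exact strictConcaveOn_log_Ioi.concaveOn.le_map_sum (fun k _ => by positivity)
    (by rw [OrthonormalBasis.sum_sq_norm_inner_right, hv, one_pow])
    (fun k _ => hM.eigenvalues_pos k)

end Spectral

section Fejer

variable {G T ι : Type*} [AddCommGroup G] [MeasurableSpace T] {ν : Measure T}
  [IsProbabilityMeasure ν] {χ : G → T → ℂ} [Fintype ι]

/-- The Fejér kernel of a finite family of characters. -/
def fejerKernel (χ : G → T → ℂ) (g : ι → G) (s t : T) : ℝ :=
  ‖charSum χ g (fun i => χ (g i) s) t‖ ^ 2 / Fintype.card ι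

/-- The Fejér mean of a function. -/
def fejerMean (ν : Measure T) (χ : G → T → ℂ) (g : ι → G) (f : T → ℂ) (s : T) : ℂ :=
  ∫ t, f t * (fejerKernel χ g s t : ℂ) ∂ν

theorem IsCharacterSystem.add (hχ : IsCharacterSystem ν χ) (g h : G) (t : T) :
    χ (g + h) t = χ g t * χ h t := by
  have h1 := hχ.sub (g + h) h t
  rw [add_sub_cancel_right] at h1
  rw [h1, mul_assoc, mul_comm (conj _), Complex.mul_conj, Complex.normSq_eq_norm_sq,
    hχ.norm_eq_one]
  simp

theorem fejerKernel_nonneg (g : ι → G) (s t : T) : 0 ≤ fejerKernel χ g s t := by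
  unfold fejerKernel; positivity

theorem fejerKernel_symm (g : ι → G) (s t : T) : fejerKernel χ g s t = fejerKernel χ g t s := by
  unfold fejerKernel charSum
  rw [← Complex.norm_conj, map_sum]
  simp only [map_mul, Complex.conj_conj, mul_comm]

theorem IsCharacterSystem.fejerKernel_le (hχ : IsCharacterSystem ν χ) (g : ι → G) (s t : T) :
    fejerKernel χ g s t ≤ (Fintype.card ι : ℝ) ^ 2 / Fintype.card ι := by
  unfold fejerKernel
  gcongr
  refine (hχ.norm_charSum_le g _ t).trans ?_
  simp [hχ.norm_eq_one]

theorem IsCharacterSystem.measurable_fejerKernel (hχ : IsCharacterSystem ν χ) (g : ι → G) :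
    Measurable fun p : T × T => fejerKernel χ g p.1 p.2 := by
  unfold fejerKernel charSum
  have := hχ.measurable
  fun_prop

theorem IsCharacterSystem.integral_fejerKernel_le (hχ : IsCharacterSystem ν χ) {g : ι → G}
    (hg : Function.Injective g) (s : T) : ∫ t, fejerKernel χ g s t ∂ν ≤ 1 := by
  unfold fejerKernel
  rw [integral_div, hχ.integral_sq_charSum hg]
  simp only [hχ.norm_eq_one, one_pow, Finset.sum_const, Finset.card_univ, nsmul_eq_mul, mul_one]
  exact div_self_le_one _

theorem IsCharacterSystem.integrable_mul_fejerKernel (hχ : IsCharacterSystem ν χ) (g : ι → G)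
    {f : T → ℂ} (hf : Integrable f ν) :
    Integrable (fun p : T × T => f p.2 * (fejerKernel χ g p.1 p.2 : ℂ)) (ν.prod ν) := by
  refine (hf.comp_snd ν).mul_bdd (c := (Fintype.card ι : ℝ) ^ 2 / Fintype.card ι)
    (Complex.measurable_ofReal.comp (hχ.measurable_fejerKernel g)).aestronglyMeasurable
    (ae_of_all _ fun p => ?_)
  rw [Complex.norm_real, Real.norm_of_nonneg (fejerKernel_nonneg _ _ _)]
  exact hχ.fejerKernel_le g _ _

theorem IsCharacterSystem.integrable_mul_fejerKernel_right (hχ : IsCharacterSystem ν χ)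
    (g : ι → G) {f : T → ℂ} (hf : Integrable f ν) (s : T) :
    Integrable (fun t => f t * (fejerKernel χ g s t : ℂ)) ν := by
  refine hf.mul_bdd (c := (Fintype.card ι : ℝ) ^ 2 / Fintype.card ι)
    (Complex.measurable_ofReal.comp
      ((hχ.measurable_fejerKernel g).comp measurable_prodMk_left)).aestronglyMeasurable
    (ae_of_all _ fun p => ?_)
  rw [Complex.norm_real, Real.norm_of_nonneg (fejerKernel_nonneg _ _ _)]
  exact hχ.fejerKernel_le g _ _

theorem IsCharacterSystem.integrable_fejerMean (hχ : IsCharacterSystem ν χ) (g : ι → G)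
    {f : T → ℂ} (hf : Integrable f ν) : Integrable (fejerMean ν χ g f) ν :=
  (hχ.integrable_mul_fejerKernel g hf).integral_prod_left

theorem IsCharacterSystem.fejerMean_add (hχ : IsCharacterSystem ν χ) (g : ι → G) {f h : T → ℂ}
    (hf : Integrable f ν) (hh : Integrable h ν) (s : T) :
    fejerMean ν χ g (f + h) s = fejerMean ν χ g f s + fejerMean ν χ g h s := by
  unfold fejerMean
  rw [← integral_add (hχ.integrable_mul_fejerKernel_right g hf s)
    (hχ.integrable_mul_fejerKernel_right g hh s)]
  simp only [Pi.add_apply, add_mul]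

theorem IsCharacterSystem.fejerMean_sub (hχ : IsCharacterSystem ν χ) (g : ι → G) {f h : T → ℂ}
    (hf : Integrable f ν) (hh : Integrable h ν) (s : T) :
    fejerMean ν χ g (fun t => f t - h t) s = fejerMean ν χ g f s - fejerMean ν χ g h s := by
  unfold fejerMean
  rw [← integral_sub (hχ.integrable_mul_fejerKernel_right g hf s)
    (hχ.integrable_mul_fejerKernel_right g hh s)]
  simp only [sub_mul]

theorem fejerMean_smul (g : ι → G) (a : ℂ) (f : T → ℂ) (s : T) :
    fejerMean ν χ g (a • f) s = a * fejerMean ν χ g f s := by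
  unfold fejerMean
  simp only [Pi.smul_apply, smul_eq_mul, mul_assoc]
  rw [integral_const_mul]

theorem IsCharacterSystem.integrable_norm_fejerMean_sub (hχ : IsCharacterSystem ν χ) (g : ι → G)
    {f : T → ℂ} (hf : Integrable f ν) :
    Integrable (fun s => ‖fejerMean ν χ g f s - f s‖) ν :=
  ((hχ.integrable_fejerMean g hf).sub hf).norm

/-- Taking Fejér means is a contraction of `L¹`. -/
theorem IsCharacterSystem.integral_norm_fejerMean_le (hχ : IsCharacterSystem ν χ) {g : ι → G}
    (hg : Function.Injective g) {f : T → ℂ} (hf : Integrable f ν) :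
    ∫ s, ‖fejerMean ν χ g f s‖ ∂ν ≤ ∫ t, ‖f t‖ ∂ν := by
  have hF := (hχ.integrable_mul_fejerKernel g hf).norm
  calc ∫ s, ‖fejerMean ν χ g f s‖ ∂ν
      ≤ ∫ s, ∫ t, ‖f t * (fejerKernel χ g s t : ℂ)‖ ∂ν ∂ν :=
        integral_mono (hχ.integrable_fejerMean g hf).norm hF.integral_prod_left
          fun s => norm_integral_le_integral_norm _
    _ = ∫ t, ∫ s, ‖f t * (fejerKernel χ g s t : ℂ)‖ ∂ν ∂ν :=
        integral_integral_swap hF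
    _ ≤ ∫ t, ‖f t‖ ∂ν := by
        refine integral_mono hF.integral_prod_right hf.norm fun t => ?_
        simp only [norm_mul, Complex.norm_real, Real.norm_of_nonneg (fejerKernel_nonneg _ _ _)]
        rw [integral_const_mul]
        simp only [fejerKernel_symm g _ t]
        exact mul_le_of_le_one_right (norm_nonneg _) (hχ.integral_fejerKernel_le hg t)

/-- The fraction of pairs of indices whose characters differ by `m`. -/
def overlap [DecidableEq G] (g : ι → G) (m : G) : ℝ :=
  (Finset.univ.filter fun p : ι × ι => g p.2 = m + g p.1).card / Fintype.card ι

theorem IsCharacterSystem.fejerMean_char [DecidableEq G] (hχ : IsCharacterSystem ν χ)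
    (g : ι → G) (m : G) (s : T) :
    fejerMean ν χ g (χ m) s = overlap g m * χ m s := by
  have hm : Integrable (χ m) ν := by
    simpa using hχ.integrable_mul_char m (integrable_const (1 : ℂ))
  have hi : ∀ p : ι × ι, Integrable (fun t => conj (χ (g p.1) s) * χ (g p.2) s *
      (χ m t * χ (g p.1 - g p.2) t) / Fintype.card ι) ν := fun p =>
    ((hχ.integrable_mul_char _ hm).const_mul _).div_const _
  have hpt : ∀ t, χ m t * (fejerKernel χ g s t : ℂ) = ∑ p : ι × ι, conj (χ (g p.1) s) *
      χ (g p.2) s * (χ m t * χ (g p.1 - g p.2) t) / Fintype.card ι := by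
    intro t
    unfold fejerKernel
    rw [Complex.ofReal_div, hχ.sq_charSum, ← Fintype.sum_prod_type'
      (f := fun i j => conj (χ (g i) s) * χ (g j) s * χ (g i - g j) t), mul_div_assoc',
      Finset.mul_sum, Complex.ofReal_natCast, Finset.sum_div]
    refine Finset.sum_congr rfl fun p _ => ?_
    ring
  unfold fejerMean
  simp only [hpt]
  rw [integral_finsetSum _ fun p _ => hi p]
  have hval : ∀ p : ι × ι, ∫ t, conj (χ (g p.1) s) * χ (g p.2) s *
      (χ m t * χ (g p.1 - g p.2) t) / Fintype.card ι ∂ν =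
      if g p.2 = m + g p.1 then χ m s / Fintype.card ι else 0 := by
    intro p
    rw [integral_div, integral_const_mul]
    simp only [← hχ.add]
    rw [hχ.integral]
    by_cases h : g p.2 = m + g p.1
    · have h0 : m + (g p.1 - g p.2) = 0 := by rw [h]; abel
      rw [if_pos h0, if_pos h, mul_one, mul_comm (conj _), ← hχ.sub, h, add_sub_cancel_right]
    · have h0 : m + (g p.1 - g p.2) ≠ 0 := fun h' => h (by
        rw [← sub_eq_zero, ← neg_eq_zero, ← h']; abel)
      rw [if_neg h0, if_neg h, mul_zero, zero_div]
  simp only [hval]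
  rw [← Finset.sum_filter, Finset.sum_const, nsmul_eq_mul, overlap]
  push_cast; ring

end Fejer

section Limit

variable {G T J : Type*} [AddCommGroup G] [DecidableEq G] [MeasurableSpace T] {ν : Measure T}
  [IsProbabilityMeasure ν] {χ : G → T → ℂ} {ι : J → Type*} [∀ j, Fintype (ι j)]
  {g : ∀ j, ι j → G} {l : Filter J}

theorem IsCharacterSystem.integrable_of_mem_span (hχ : IsCharacterSystem ν χ) {P : T → ℂ}
    (hP : P ∈ Submodule.span ℂ (Set.range χ)) : Integrable P ν := by
  induction hP using Submodule.span_induction with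
  | mem x h =>
    obtain ⟨m, rfl⟩ := h
    simpa using hχ.integrable_mul_char m (integrable_const (1 : ℂ))
  | zero => exact integrable_zero _ _ _
  | add x y _ _ hx hy => exact hx.add hy
  | smul a x _ hx => exact hx.smul a

theorem IsCharacterSystem.tendsto_fejerMean_of_mem_span (hχ : IsCharacterSystem ν χ)
    (ho : ∀ m, Tendsto (fun j => overlap (g j) m) l (𝓝 1)) {P : T → ℂ}
    (hP : P ∈ Submodule.span ℂ (Set.range χ)) :
    Tendsto (fun j => ∫ s, ‖fejerMean ν χ (g j) P s - P s‖ ∂ν) l (𝓝 0) := by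
  induction hP using Submodule.span_induction with
  | mem x h =>
    obtain ⟨m, rfl⟩ := h
    have : ∀ j, ∫ s, ‖fejerMean ν χ (g j) (χ m) s - χ m s‖ ∂ν = |overlap (g j) m - 1| := by
      intro j
      have : ∀ s, ‖fejerMean ν χ (g j) (χ m) s - χ m s‖ = |overlap (g j) m - 1| := by
        intro s
        rw [hχ.fejerMean_char, ← sub_one_mul, norm_mul, hχ.norm_eq_one, mul_one]
        exact_mod_cast Complex.norm_real _
      simp [this]
    simp only [this]
    simpa using ((ho m).sub_const 1).abs
  | zero => simpa [fejerMean] using tendsto_const_nhds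
  | add x y hx hy h1 h2 =>
    have ix := hχ.integrable_of_mem_span hx
    have iy := hχ.integrable_of_mem_span hy
    refine squeeze_zero (fun j => integral_nonneg fun s => norm_nonneg _) (fun j => ?_)
      (by simpa using h1.add h2)
    have jx := hχ.integrable_norm_fejerMean_sub (g j) ix
    have jy := hχ.integrable_norm_fejerMean_sub (g j) iy
    have jxy := hχ.integrable_norm_fejerMean_sub (g j) (ix.add iy)
    rw [← integral_add jx jy]
    refine integral_mono jxy (jx.add jy) fun s => ?_
    simp only [Pi.add_apply, hχ.fejerMean_add (g j) ix iy]
    rw [add_sub_add_comm]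
    exact norm_add_le _ _
  | smul a x hx h =>
    have := h.const_mul ‖a‖
    rw [mul_zero] at this
    refine this.congr fun j => ?_
    rw [← integral_const_mul]
    refine integral_congr_ae (ae_of_all _ fun s => ?_)
    simp only [fejerMean_smul, Pi.smul_apply, smul_eq_mul]
    rw [← mul_sub, norm_mul]

/-- Fejér means converge in `L¹`. -/
theorem IsCharacterSystem.tendsto_fejerMean (hχ : IsCharacterSystem ν χ)
    (hg : ∀ j, Function.Injective (g j))
    (ho : ∀ m, Tendsto (fun j => overlap (g j) m) l (𝓝 1)) {f : T → ℂ} (hf : Integrable f ν) :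
    Tendsto (fun j => ∫ s, ‖fejerMean ν χ (g j) f s - f s‖ ∂ν) l (𝓝 0) := by
  rw [Metric.tendsto_nhds]
  intro ε hε
  obtain ⟨P, hP, hPε⟩ := hχ.dense f hf (ε / 4) (by positivity)
  have iP := hχ.integrable_of_mem_span hP
  have hlim := hχ.tendsto_fejerMean_of_mem_span ho hP
  filter_upwards [hlim.eventually_lt_const (show (0 : ℝ) < ε / 4 by positivity)] with j hj
  rw [Real.dist_eq, sub_zero, abs_of_nonneg (integral_nonneg fun s => norm_nonneg _)]
  have hfP : Integrable (fun t => f t - P t) ν := hf.sub iP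
  have h1 := hχ.integral_norm_fejerMean_le (hg j) hfP
  have i1 := (hχ.integrable_fejerMean (g j) hfP).norm
  have i2 := hχ.integrable_norm_fejerMean_sub (g j) iP
  have i0 := hχ.integrable_norm_fejerMean_sub (g j) hf
  have h2 : ∫ s, ‖fejerMean ν χ (g j) f s - f s‖ ∂ν ≤
      ∫ s, (‖fejerMean ν χ (g j) (fun t => f t - P t) s‖ +
        ‖fejerMean ν χ (g j) P s - P s‖ + ‖f s - P s‖) ∂ν := by
    refine integral_mono i0 ((i1.add i2).add hfP.norm) fun s => ?_
    simp only [hχ.fejerMean_sub (g j) hf iP]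
    rw [norm_sub_rev (f s)]
    refine le_trans (le_of_eq ?_) (norm_add₃_le)
    congr 1; ring
  have h3 : ∫ s, (‖fejerMean ν χ (g j) (fun t => f t - P t) s‖ +
        ‖fejerMean ν χ (g j) P s - P s‖ + ‖f s - P s‖) ∂ν =
      ∫ s, ‖fejerMean ν χ (g j) (fun t => f t - P t) s‖ ∂ν +
        ∫ s, ‖fejerMean ν χ (g j) P s - P s‖ ∂ν + ∫ s, ‖f s - P s‖ ∂ν := by
    rw [← integral_add i1 i2]
    exact integral_add (i1.add i2) hfP.norm
  linarith

end Limit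

theorem integrable_log_one_add {T : Type*} [MeasurableSpace T] {ν : Measure T} {f : T → ℝ} {ρ : ℝ}
    (hρ : 0 < ρ) (hf : Integrable f ν) (hf0 : ∀ᵐ t ∂ν, 0 ≤ f t) :
    Integrable (fun t => Real.log (1 + ρ * f t)) ν := by
  refine (hf.const_mul ρ).mono' ?_ ?_
  · exact (Real.measurable_log.comp_aemeasurable
      ((hf.aemeasurable.const_mul ρ).const_add 1)).aestronglyMeasurable
  · filter_upwards [hf0] with t ht
    have h := mul_nonneg hρ.le ht
    rw [Real.norm_of_nonneg (Real.log_nonneg (by linarith))]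
    linarith [Real.log_le_sub_one_of_pos (show 0 < 1 + ρ * f t by linarith)]

theorem log_one_add_le_add_abs {ρ a b : ℝ} (hρ : 0 < ρ) (ha : 0 ≤ a) (hb : 0 ≤ b) :
    Real.log (1 + ρ * a) ≤ Real.log (1 + ρ * b) + ρ * |a - b| := by
  have h1 : 0 ≤ ρ * a := by positivity
  have h2 : 0 ≤ ρ * b := by positivity
  have hd : 0 ≤ ρ * |a - b| := by positivity
  have h3 : 1 + ρ * a ≤ (1 + ρ * b) * (1 + ρ * |a - b|) := by
    have := mul_le_mul_of_nonneg_left (le_abs_self (a - b)) hρ.le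
    nlinarith [mul_nonneg h2 hd]
  calc Real.log (1 + ρ * a) ≤ Real.log ((1 + ρ * b) * (1 + ρ * |a - b|)) :=
        Real.log_le_log (by linarith) h3
    _ = Real.log (1 + ρ * b) + Real.log (1 + ρ * |a - b|) :=
        Real.log_mul (by positivity) (by positivity)
    _ ≤ _ := by
        linarith [Real.log_le_sub_one_of_pos (show 0 < 1 + ρ * |a - b| by linarith)]

section Bounds

variable {G T ι : Type*} [AddCommGroup G] [MeasurableSpace T] {ν : Measure T}
  [IsProbabilityMeasure ν] {χ : G → T → ℂ} [Fintype ι] [DecidableEq ι]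

/-- The Toeplitz matrix of `r` on the index family `g`. -/
def toeplitz (r : G → ℂ) (g : ι → G) : Matrix ι ι ℂ := Matrix.of fun i j => r (g i - g j)

theorem posDef_maskedMatrix {K : Matrix ι ι ℂ} (hK : K.PosSemidef) {ρ : ℝ} (hρ : 0 ≤ ρ)
    (x : EuclideanSpace ℂ ι) : (maskedMatrix ρ K x).PosDef := by
  refine Matrix.PosDef.one.add_posSemidef ?_
  have := (Matrix.posSemidef_vecMulVec_self_star x.ofLp).hadamard hK
  exact this.smul (by exact_mod_cast hρ)

theorem IsCharacterSystem.sum_mul_maskedMatrix (hχ : IsCharacterSystem ν χ) {S : T → ℝ}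
    (hS : Integrable S ν) {r : G → ℂ} (hr : ∀ g, r g = ∫ t, (S t : ℂ) * χ g t ∂ν)
    (g : ι → G) (ρ : ℝ) (x u : EuclideanSpace ℂ ι) :
    ∑ i, ∑ j, conj (u i) * u j * maskedMatrix ρ (toeplitz r g) x i j =
      ((‖u‖ ^ 2 + ρ * ∫ t, S t * ‖charSum χ g (fun i => conj (x i) * u i) t‖ ^ 2 ∂ν : ℝ) : ℂ) := by
  have h1 : ∀ i j, conj (u i) * u j * maskedMatrix ρ (toeplitz r g) x i j =
      (if i = j then conj (u i) * u j else 0) + ρ * (conj (conj (x i) * u i) *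
        (conj (x j) * u j) * r (g i - g j)) := by
    intro i j
    simp only [maskedMatrix, toeplitz, Matrix.add_apply, Matrix.one_apply, Matrix.smul_apply,
      Matrix.hadamard_apply, Matrix.vecMulVec_apply, Matrix.of_apply, Pi.star_apply,
      RCLike.star_def, smul_eq_mul, map_mul, Complex.conj_conj]
    split_ifs <;> ring
  simp only [h1, Finset.sum_add_distrib, Finset.sum_ite_eq, Finset.mem_univ, if_true,
    ← Finset.mul_sum]
  rw [← hχ.integral_mul_sq_charSum hS hr, EuclideanSpace.norm_sq_eq]
  push_cast
  congr 1
  refine Finset.sum_congr rfl fun i _ => ?_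
  rw [mul_comm, Complex.mul_conj, Complex.normSq_eq_norm_sq]
  push_cast; rfl

theorem charSum_mask_eq_inner (g : ι → G) (x u : EuclideanSpace ℂ ι) (t : T) :
    charSum χ g (fun i => conj (x i) * u i) t =
      inner ℂ u (WithLp.toLp 2 fun i => x i * χ (g i) t) := by
  rw [EuclideanSpace.inner_eq_star_dotProduct]
  simp only [charSum, dotProduct, Pi.star_apply, RCLike.star_def, map_mul, Complex.conj_conj]
  exact Finset.sum_congr rfl fun i _ => by ring

/-- Lower bound for the log-determinant of a masked Toeplitz matrix: Jensen's inequality for each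
eigenvalue, weighted with the squared modulus of the masked eigenpolynomial. -/
theorem IsCharacterSystem.integral_log_le_normLogDet (hχ : IsCharacterSystem ν χ) {S : T → ℝ}
    (hS : Integrable S ν) (hS0 : ∀ᵐ t ∂ν, 0 ≤ S t) {r : G → ℂ}
    (hr : ∀ g, r g = ∫ t, (S t : ℂ) * χ g t ∂ν) {g : ι → G} (hg : Function.Injective g)
    {ρ : ℝ} (hρ : 0 < ρ) {x : EuclideanSpace ℂ ι} (hx1 : ∀ i, ‖x i‖ ≤ 1) (hx0 : x ≠ 0)
    (hM : (maskedMatrix ρ (toeplitz r g) x).PosDef) :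
    ∫ t, Real.log (1 + ρ * S t) ∂ν ≤ normLogDet ρ (toeplitz r g) x := by
  set b := hM.isHermitian.eigenvectorBasis with hb
  set ev := hM.isHermitian.eigenvalues with hev
  have hlog := integrable_log_one_add hρ hS hS0
  set p : ι → T → ℂ := fun k => charSum χ g (fun i => conj (x i) * b k i) with hp
  have hsum : ∀ t, ∑ k, ‖p k t‖ ^ 2 = ‖x‖ ^ 2 := by
    intro t
    simp only [hp, charSum_mask_eq_inner]
    rw [b.sum_sq_norm_inner_right, EuclideanSpace.norm_sq_eq, EuclideanSpace.norm_sq_eq]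
    simp [hχ.norm_eq_one]
  have key : ∀ k, ∫ t, Real.log (1 + ρ * S t) * ‖p k t‖ ^ 2 ∂ν ≤ Real.log (ev k) := by
    intro k
    have hpos : 0 < ev k := hM.eigenvalues_pos k
    have hbk : ‖b k‖ = 1 := b.norm_eq_one k
    have hev' : ev k = 1 + ρ * ∫ t, S t * ‖p k t‖ ^ 2 ∂ν := by
      have h := (eigenvalues_eq_sum hM.isHermitian k).trans
        (hχ.sum_mul_maskedMatrix hS hr g ρ x (b k))
      rw [hbk, one_pow] at h
      exact_mod_cast h
    have hw : ∫ t, ‖p k t‖ ^ 2 ∂ν ≤ 1 := by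
      rw [hp, hχ.integral_sq_charSum hg]
      calc ∑ i, ‖conj (x i) * b k i‖ ^ 2 ≤ ∑ i, ‖b k i‖ ^ 2 := by
            gcongr with i
            rw [norm_mul, RCLike.norm_conj]
            exact mul_le_of_le_one_left (norm_nonneg _) (hx1 i)
        _ = 1 := by rw [← EuclideanSpace.norm_sq_eq, hbk, one_pow]
    set w := ∫ t, ‖p k t‖ ^ 2 ∂ν
    have i1 := hχ.integrable_sq_charSum g (fun i => conj (x i) * b k i)
    have i2 := hχ.integrable_mul_charSum g (fun i => conj (x i) * b k i) hS
    have i3 := hχ.integrable_mul_charSum g (fun i => conj (x i) * b k i) hlog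
    have hle : ∫ t, Real.log (1 + ρ * S t) * ‖p k t‖ ^ 2 ∂ν ≤
        ∫ t, ((Real.log (ev k) + 1 / ev k - 1) * ‖p k t‖ ^ 2 +
          ρ / ev k * (S t * ‖p k t‖ ^ 2)) ∂ν := by
      refine integral_mono_ae i3 ((i1.const_mul _).add (i2.const_mul _)) ?_
      filter_upwards [hS0] with t ht
      have h1 : 0 < 1 + ρ * S t := by positivity
      have h2 := Real.log_le_sub_one_of_pos (div_pos h1 hpos)
      rw [Real.log_div h1.ne' hpos.ne'] at h2
      have h3 : Real.log (1 + ρ * S t) ≤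
          (Real.log (ev k) + 1 / ev k - 1) + ρ / ev k * S t := by
        have : (1 + ρ * S t) / ev k = 1 / ev k + ρ / ev k * S t := by field_simp
        linarith
      calc _ ≤ ((Real.log (ev k) + 1 / ev k - 1) + ρ / ev k * S t) * ‖p k t‖ ^ 2 := by gcongr
        _ = _ := by ring
    rw [integral_add (i1.const_mul _) (i2.const_mul _), integral_const_mul,
      integral_const_mul] at hle
    refine hle.trans ?_
    have h4 : ρ / ev k * ∫ t, S t * ‖p k t‖ ^ 2 ∂ν = (ev k - 1) / ev k := by
      rw [div_mul_eq_mul_div, hev', add_sub_cancel_left]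
    have h5 := Real.one_sub_inv_le_log_of_pos hpos
    change (Real.log (ev k) + 1 / ev k - 1) * w + ρ / ev k * ∫ t, S t * ‖p k t‖ ^ 2 ∂ν ≤ _
    rw [h4, sub_div, div_self hpos.ne', one_div]
    nlinarith [mul_nonneg (sub_nonneg.2 hw) (sub_nonneg.2 h5)]
  have hxpos : 0 < ‖x‖ ^ 2 := by positivity
  unfold normLogDet
  rw [one_div, inv_mul_eq_div, le_div_iff₀ hxpos, log_det_eq_sum hM, ← integral_mul_const]
  have hpt : ∀ t, Real.log (1 + ρ * S t) * ‖x‖ ^ 2 =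
      ∑ k, Real.log (1 + ρ * S t) * ‖p k t‖ ^ 2 := fun t => by rw [← hsum t, Finset.mul_sum]
  simp only [hpt]
  rw [integral_finsetSum _ fun k _ => hχ.integrable_mul_charSum g _ hlog]
  exact Finset.sum_le_sum fun k _ => key k

/-- The Fejér mean of a real function. -/
def realFejerMean (ν : Measure T) (χ : G → T → ℂ) (g : ι → G) (S : T → ℝ) (s : T) : ℝ :=
  ∫ t, S t * fejerKernel χ g s t ∂ν

omit [DecidableEq ι] in
theorem fejerMean_ofReal (g : ι → G) (S : T → ℝ) (s : T) :
    fejerMean ν χ g (fun t => (S t : ℂ)) s = realFejerMean ν χ g S s := by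
  unfold fejerMean realFejerMean
  rw [← integral_complex_ofReal]
  simp only [Complex.ofReal_mul]

omit [DecidableEq ι] in
theorem IsCharacterSystem.integrable_realFejerMean (hχ : IsCharacterSystem ν χ) (g : ι → G)
    {S : T → ℝ} (hS : Integrable S ν) : Integrable (realFejerMean ν χ g S) ν := by
  have := (hχ.integrable_fejerMean g hS.ofReal).re
  refine this.congr (ae_of_all _ fun s => ?_)
  exact (congrArg Complex.re (fejerMean_ofReal g S s)).trans (Complex.ofReal_re _)

omit [DecidableEq ι] in
theorem IsCharacterSystem.realFejerMean_nonneg (hχ : IsCharacterSystem ν χ) {S : T → ℝ}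
    (hS : Integrable S ν) {r : G → ℂ} (hr : ∀ g, r g = ∫ t, (S t : ℂ) * χ g t ∂ν) {g : ι → G}
    (hK : (toeplitz r g).PosSemidef) (s : T) : 0 ≤ realFejerMean ν χ g S s := by
  unfold realFejerMean fejerKernel
  simp only [mul_div_assoc']
  rw [integral_div]
  refine div_nonneg ?_ (Nat.cast_nonneg _)
  have h := hχ.integral_mul_sq_charSum hS hr g (fun i => χ (g i) s)
  have h2 := hK.dotProduct_mulVec_nonneg (fun i => χ (g i) s)
  have h3 : star (fun i => χ (g i) s) ⬝ᵥ toeplitz r g *ᵥ (fun i => χ (g i) s) =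
      ∑ i, ∑ j, conj (χ (g i) s) * χ (g j) s * r (g i - g j) := by
    simp only [dotProduct, Matrix.mulVec, Finset.mul_sum, Pi.star_apply, RCLike.star_def, toeplitz,
      Matrix.of_apply]
    exact Finset.sum_congr rfl fun i _ => Finset.sum_congr rfl fun j _ => by ring
  rw [h3, ← h] at h2
  exact_mod_cast h2

theorem norm_sq_ones : ‖ones ι‖ ^ 2 = (Fintype.card ι : ℝ) := by
  rw [EuclideanSpace.norm_sq_eq]
  simp [ones]

/-- Upper bound for the log-determinant of a Toeplitz matrix: Jensen's inequality for the spectral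
measure of the vector of characters at each point. -/
theorem IsCharacterSystem.normLogDet_ones_le (hχ : IsCharacterSystem ν χ) {S : T → ℝ}
    (hS : Integrable S ν) {r : G → ℂ} (hr : ∀ g, r g = ∫ t, (S t : ℂ) * χ g t ∂ν) {g : ι → G}
    (hg : Function.Injective g) [Nonempty ι] (hK : (toeplitz r g).PosSemidef)
    {ρ : ℝ} (hρ : 0 < ρ) :
    normLogDet ρ (toeplitz r g) (ones ι) ≤
      ∫ s, Real.log (1 + ρ * realFejerMean ν χ g S s) ∂ν := by
  have hM := posDef_maskedMatrix hK hρ.le (ones ι)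
  set b := hM.isHermitian.eigenvectorBasis with hb
  set ev := hM.isHermitian.eigenvalues with hev
  set n : ℝ := (Fintype.card ι : ℝ) with hn
  have hn0 : 0 < n := by rw [hn]; exact_mod_cast Fintype.card_pos
  have hsq : ‖((√n)⁻¹ : ℂ)‖ ^ 2 = n⁻¹ := by
    rw [norm_inv, Complex.norm_real, Real.norm_of_nonneg (Real.sqrt_nonneg _), inv_pow,
      Real.sq_sqrt hn0.le]
  set v : T → EuclideanSpace ℂ ι := fun s => WithLp.toLp 2 fun i => ((√n)⁻¹ : ℂ) * χ (g i) s
    with hv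
  have hv1 : ∀ s, ‖v s‖ = 1 := by
    intro s
    have : ‖v s‖ ^ 2 = 1 := by
      rw [EuclideanSpace.norm_sq_eq]
      simp only [hv, norm_mul, hsq, hχ.norm_eq_one, mul_one, Finset.sum_const,
        Finset.card_univ, nsmul_eq_mul]
      exact mul_inv_cancel₀ hn0.ne'
    exact (sq_eq_sq₀ (norm_nonneg _) zero_le_one).1 (by rw [this, one_pow])
  have hquad : ∀ s, (∑ i, ∑ j, conj (v s i) * v s j *
      maskedMatrix ρ (toeplitz r g) (ones ι) i j).re = 1 + ρ * realFejerMean ν χ g S s := by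
    intro s
    rw [hχ.sum_mul_maskedMatrix hS hr, Complex.ofReal_re, hv1, one_pow]
    unfold realFejerMean fejerKernel
    congr 3 with t
    congr 1
    have : charSum χ g (fun i => conj (ones ι i) * v s i) t =
        ((√n)⁻¹ : ℂ) * charSum χ g (fun i => χ (g i) s) t := by
      simp only [charSum, ones, hv, map_one, one_mul, map_mul, Finset.mul_sum, map_inv₀,
        Complex.conj_ofReal, mul_assoc]
    rw [this, norm_mul, mul_pow, hsq, inv_mul_eq_div]
  have hin : ∀ k s, ‖inner ℂ (b k) (v s)‖ ^ 2 = n⁻¹ * ‖charSum χ g (b k) s‖ ^ 2 := by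
    intro k s
    have : inner ℂ (b k) (v s) = ((√n)⁻¹ : ℂ) * charSum χ g (b k) s := by
      rw [EuclideanSpace.inner_eq_star_dotProduct]
      simp only [charSum, dotProduct, hv, Pi.star_apply, RCLike.star_def, Finset.mul_sum]
      exact Finset.sum_congr rfl fun i _ => by ring
    rw [this, norm_mul, mul_pow, hsq]
  have hint : ∀ k, ∫ s, ‖inner ℂ (b k) (v s)‖ ^ 2 ∂ν = n⁻¹ := by
    intro k
    simp only [hin]
    rw [integral_const_mul, hχ.integral_sq_charSum hg, ← EuclideanSpace.norm_sq_eq,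
      b.norm_eq_one, one_pow, mul_one]
  have hintg : ∀ k, Integrable (fun s => ‖inner ℂ (b k) (v s)‖ ^ 2 * Real.log (ev k)) ν := by
    intro k
    simp only [hin]
    exact ((hχ.integrable_sq_charSum g (b k)).const_mul _).mul_const _
  calc normLogDet ρ (toeplitz r g) (ones ι)
      = ∑ k, ∫ s, ‖inner ℂ (b k) (v s)‖ ^ 2 * Real.log (ev k) ∂ν := by
        simp only [integral_mul_const, hint]
        rw [← Finset.mul_sum, normLogDet, log_det_eq_sum hM, norm_sq_ones, one_div]
    _ = ∫ s, ∑ k, ‖inner ℂ (b k) (v s)‖ ^ 2 * Real.log (ev k) ∂ν :=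
        (integral_finsetSum _ fun k _ => hintg k).symm
    _ ≤ _ := by
        refine integral_mono (integrable_finsetSum _ fun k _ => hintg k)
          (integrable_log_one_add hρ (hχ.integrable_realFejerMean g hS)
            (ae_of_all _ (hχ.realFejerMean_nonneg hS hr hK))) fun s => ?_
        simp only [← hquad]
        exact sum_log_eigenvalues_le hM (hv1 s)

end Bounds

section Limit

variable {G T J : Type*} [AddCommGroup G] [DecidableEq G] [MeasurableSpace T] {ν : Measure T}
  [IsProbabilityMeasure ν] {χ : G → T → ℂ} {ι : J → Type*} [∀ j, Fintype (ι j)]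
  [∀ j, DecidableEq (ι j)] {g : ∀ j, ι j → G} {l : Filter J}

omit [∀ j, DecidableEq (ι j)] in
theorem IsCharacterSystem.tendsto_realFejerMean (hχ : IsCharacterSystem ν χ)
    (hg : ∀ j, Function.Injective (g j))
    (ho : ∀ m, Tendsto (fun j => overlap (g j) m) l (𝓝 1)) {S : T → ℝ} (hS : Integrable S ν) :
    Tendsto (fun j => ∫ s, |realFejerMean ν χ (g j) S s - S s| ∂ν) l (𝓝 0) := by
  refine (hχ.tendsto_fejerMean hg ho hS.ofReal).congr fun j => ?_
  refine integral_congr_ae (ae_of_all _ fun s => ?_)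
  have h := fejerMean_ofReal (ν := ν) (χ := χ) (g j) S s
  simp only [RCLike.ofReal_eq_complex_ofReal] at *
  rw [h, ← Complex.ofReal_sub, Complex.norm_real, Real.norm_eq_abs]

omit [∀ j, DecidableEq (ι j)] in
/-- A symbol with positive semidefinite Toeplitz matrices is nonnegative. -/
theorem IsCharacterSystem.ae_nonneg [l.NeBot] (hχ : IsCharacterSystem ν χ)
    (hg : ∀ j, Function.Injective (g j))
    (ho : ∀ m, Tendsto (fun j => overlap (g j) m) l (𝓝 1)) {S : T → ℝ} (hS : Integrable S ν)
    {r : G → ℂ} (hr : ∀ g, r g = ∫ t, (S t : ℂ) * χ g t ∂ν)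
    (hK : ∀ j, (toeplitz r (g j)).PosSemidef) : ∀ᵐ t ∂ν, 0 ≤ S t := by
  have hle : ∫ t, max (-S t) 0 ∂ν ≤ 0 := by
    refine ge_of_tendsto' (hχ.tendsto_realFejerMean hg ho hS) fun j => ?_
    refine integral_mono hS.neg_part
      ((hχ.integrable_realFejerMean (g j) hS).sub hS).abs fun s => ?_
    have h0 := hχ.realFejerMean_nonneg hS hr (hK j) s
    refine max_le ?_ (abs_nonneg _)
    exact le_trans (by linarith) (le_abs_self _)
  have h0 : ∫ t, max (-S t) 0 ∂ν = 0 :=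
    le_antisymm hle (integral_nonneg fun t => le_max_right _ _)
  replace h0 := (integral_eq_zero_iff_of_nonneg (fun t => le_max_right (-S t) 0) hS.neg_part).1 h0
  filter_upwards [h0] with t ht
  have := le_max_left (-S t) 0
  simp only [Pi.zero_apply] at ht
  linarith

/-- Szegő's limit theorem. -/
theorem IsCharacterSystem.tendsto_normLogDet_ones (hχ : IsCharacterSystem ν χ)
    (hg : ∀ j, Function.Injective (g j)) (hne : ∀ᶠ j in l, Nonempty (ι j))
    (ho : ∀ m, Tendsto (fun j => overlap (g j) m) l (𝓝 1)) {S : T → ℝ} (hS : Integrable S ν)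
    (hS0 : ∀ᵐ t ∂ν, 0 ≤ S t) {r : G → ℂ} (hr : ∀ g, r g = ∫ t, (S t : ℂ) * χ g t ∂ν)
    (hK : ∀ j, (toeplitz r (g j)).PosSemidef) {ρ : ℝ} (hρ : 0 < ρ) :
    Tendsto (fun j => normLogDet ρ (toeplitz r (g j)) (ones (ι j))) l
      (𝓝 (∫ t, Real.log (1 + ρ * S t) ∂ν)) := by
  have hup : Tendsto (fun j => ∫ t, Real.log (1 + ρ * S t) ∂ν +
      ρ * ∫ s, |realFejerMean ν χ (g j) S s - S s| ∂ν) l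
      (𝓝 (∫ t, Real.log (1 + ρ * S t) ∂ν)) := by
    simpa using ((hχ.tendsto_realFejerMean hg ho hS).const_mul ρ).const_add
      (∫ t, Real.log (1 + ρ * S t) ∂ν)
  have hlog := integrable_log_one_add hρ hS hS0
  refine tendsto_of_tendsto_of_tendsto_of_le_of_le' tendsto_const_nhds hup ?_ ?_
  · filter_upwards [hne] with j hj
    refine hχ.integral_log_le_normLogDet hS hS0 hr (hg j) hρ (fun i => by simp [ones]) ?_
      (posDef_maskedMatrix (hK j) hρ.le _)
    intro h
    have h1 := norm_sq_ones (ι := ι j)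
    rw [h, norm_zero] at h1
    have h2 : (0 : ℝ) < Fintype.card (ι j) := by exact_mod_cast Fintype.card_pos
    rw [← h1] at h2
    norm_num at h2
  · filter_upwards [hne] with j hj
    refine (hχ.normLogDet_ones_le hS hr (hg j) (hK j) hρ).trans ?_
    have iq := hχ.integrable_realFejerMean (g j) hS
    have id : Integrable (fun s => |realFejerMean ν χ (g j) S s - S s|) ν := (iq.sub hS).abs
    rw [← integral_const_mul, ← integral_add hlog (id.const_mul ρ)]
    have hq0 := hχ.realFejerMean_nonneg hS hr (hK j)
    refine integral_mono_ae (integrable_log_one_add hρ iq (ae_of_all _ hq0))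
      (hlog.add (id.const_mul ρ)) ?_
    filter_upwards [hS0] with s hs
    exact log_one_add_le_add_abs hρ (hq0 s) hs

end Limit

/-- Uniform density of a family of continuous functions on a compact space gives `L¹` density of
their pullbacks along a measurable map with an almost everywhere left inverse. -/
theorem exists_mem_span_integral_sub_le {G T Y : Type*} [MeasurableSpace T] {ν : Measure T}
    [IsProbabilityMeasure ν] [PseudoEMetricSpace Y] [CompactSpace Y] [MeasurableSpace Y]
    [BorelSpace Y] {π : T → Y} (hπ : Measurable π) {σ : Y → T} (hσ : Measurable σ)
    (hσπ : ∀ᵐ t ∂ν, σ (π t) = t) {ψ : G → C(Y, ℂ)}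
    (hψ : (Submodule.span ℂ (Set.range ψ)).topologicalClosure = ⊤) {f : T → ℂ}
    (hf : Integrable f ν) {ε : ℝ} (hε : 0 < ε) :
    ∃ P ∈ Submodule.span ℂ (Set.range fun g t => ψ g (π t)), ∫ t, ‖f t - P t‖ ∂ν ≤ ε := by
  have : IsProbabilityMeasure (ν.map π) := Measure.isProbabilityMeasure_map hπ.aemeasurable
  set F : Y → ℂ := hf.1.mk f ∘ σ with hF
  have hFm : StronglyMeasurable F := hf.1.stronglyMeasurable_mk.comp_measurable hσ
  have hFf : ∀ᵐ t ∂ν, F (π t) = f t := by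
    filter_upwards [hσπ, hf.1.ae_eq_mk] with t h1 h2
    rw [hF, Function.comp_apply, h1, h2]
  have hFi : Integrable F (ν.map π) := by
    rw [integrable_map_measure hFm.aestronglyMeasurable hπ.aemeasurable]
    exact hf.congr (hFf.mono fun t h => h.symm)
  obtain ⟨u, -, hu, huc, hui⟩ := hFi.exists_hasCompactSupport_integral_sub_le (half_pos hε)
  have hmem : (⟨u, huc⟩ : C(Y, ℂ)) ∈ (Submodule.span ℂ (Set.range ψ)).topologicalClosure := by
    rw [hψ]; trivial
  obtain ⟨Q, hQ, hQε⟩ := Metric.mem_closure_iff.1 hmem _ (half_pos hε)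
  have hQm : (fun t => Q (π t)) ∈ Submodule.span ℂ (Set.range fun g t => ψ g (π t)) := by
    clear hQε
    induction hQ using Submodule.span_induction with
    | mem x h =>
      obtain ⟨g, rfl⟩ := h
      exact Submodule.subset_span ⟨g, rfl⟩
    | zero => exact Submodule.zero_mem _
    | add x y _ _ hx hy => exact Submodule.add_mem _ hx hy
    | smul a x _ hx => exact Submodule.smul_mem _ a hx
  refine ⟨_, hQm, ?_⟩
  have hsub : Integrable (fun y => ‖F y - u y‖) (ν.map π) := (hFi.sub hui).norm
  have hsub' : Integrable (fun t => ‖F (π t) - u (π t)‖) ν := hsub.comp_measurable hπ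
  have hu' : ∫ t, ‖F (π t) - u (π t)‖ ∂ν ≤ ε / 2 := by
    rwa [integral_map hπ.aemeasurable hsub.aestronglyMeasurable] at hu
  calc ∫ t, ‖f t - Q (π t)‖ ∂ν ≤ ∫ t, (‖F (π t) - u (π t)‖ + ε / 2) ∂ν := by
        refine integral_mono_of_nonneg (ae_of_all _ fun t => norm_nonneg _)
          (hsub'.add (integrable_const _)) ?_
        filter_upwards [hFf] with t ht
        rw [ht, ← sub_add_sub_cancel (f t) (u (π t))]
        refine (norm_add_le _ _).trans (add_le_add_right ?_ _)
        rw [← dist_eq_norm]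
        exact (ContinuousMap.dist_apply_le_dist (f := ⟨u, huc⟩) (g := Q) (π t)).trans hQε.le
    _ ≤ ε := by
        rw [integral_add hsub' (integrable_const _)]
        simp; linarith

section Systems

/-- The characters `exp (2πi n θ)`. -/
def char₁ (n : ℤ) (θ : ℝ) : ℂ := Complex.exp (2 * Real.pi * Complex.I * (n * θ))

/-- The characters `exp (2πi (k θ - n φ))`. -/
def char₂ (m : ℤ × ℤ) (p : ℝ × ℝ) : ℂ :=
  Complex.exp (2 * Real.pi * Complex.I * (m.1 * p.1 - m.2 * p.2))

/-- Lebesgue measure on `[-1/2, 1/2]`. -/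
abbrev vol₁ : Measure ℝ := volume.restrict (Set.Icc (-(1 / 2)) (1 / 2))

/-- Lebesgue measure on the square. -/
abbrev vol₂ : Measure (ℝ × ℝ) := volume.restrict square

instance : IsProbabilityMeasure vol₁ := ⟨by
  rw [Measure.restrict_apply_univ, Real.volume_Icc]; norm_num⟩

theorem vol₂_eq : vol₂ = vol₁.prod vol₁ := by
  rw [vol₂, vol₁, Measure.prod_restrict, ← Measure.volume_eq_prod, square]

instance : IsProbabilityMeasure vol₂ := by
  rw [vol₂_eq]; infer_instance

/-- The representative in `(-1/2, 1/2]` of a point of the circle. -/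
def circleRep (y : UnitAddCircle) : ℝ := AddCircle.equivIoc 1 (-(1 / 2) : ℝ) y

theorem measurable_circleRep : Measurable circleRep :=
  measurable_subtype_coe.comp (AddCircle.measurableEquivIoc 1 (-(1 / 2) : ℝ)).measurable

theorem circleRep_coe : ∀ᵐ θ : ℝ ∂vol₁, circleRep (θ : UnitAddCircle) = θ := by
  rw [vol₁, ← restrict_Ioc_eq_restrict_Icc]
  filter_upwards [ae_restrict_mem measurableSet_Ioc] with θ hθ
  exact AddCircle.equivIoc_coe_of_mem (by norm_num at hθ ⊢; exact hθ)

theorem char₂_eq (m : ℤ × ℤ) (p : ℝ × ℝ) : char₂ m p = char₁ m.1 p.1 * char₁ (-m.2) p.2 := by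
  unfold char₂ char₁
  rw [← Complex.exp_add]
  congr 1; push_cast; ring

theorem char₁_eq_fourier (n : ℤ) (θ : ℝ) :
    char₁ n θ = fourier n (θ : UnitAddCircle) := by
  rw [fourier_coe_apply, char₁]
  congr 1; push_cast; ring

theorem norm_char₁ (n : ℤ) (θ : ℝ) : ‖char₁ n θ‖ = 1 := by
  rw [char₁]
  exact_mod_cast norm_exp_two_pi (n * θ)

theorem char₁_sub (m n : ℤ) (θ : ℝ) : char₁ (m - n) θ = char₁ m θ * conj (char₁ n θ) := by
  unfold char₁
  rw [← Complex.exp_conj, ← Complex.exp_add]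
  congr 1
  simp only [map_mul, Complex.conj_ofReal, Complex.conj_I, map_ofNat, map_intCast]
  push_cast; ring

theorem measurable_char₁ (n : ℤ) : Measurable (char₁ n) := by
  unfold char₁; fun_prop

theorem integral_char₁ (n : ℤ) : ∫ θ, char₁ n θ ∂vol₁ = if n = 0 then 1 else 0 :=
  integral_exp_int n

theorem isCharacterSystem_char₁ : IsCharacterSystem vol₁ char₁ where
  measurable := measurable_char₁
  norm_eq_one := norm_char₁
  sub := char₁_sub
  integral_eq_zero n hn := by rw [integral_char₁, if_neg hn]
  dense f hf ε hε := by
    have h := exists_mem_span_integral_sub_le (π := fun θ : ℝ => (θ : UnitAddCircle))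
      AddCircle.measurable_mk' measurable_circleRep circleRep_coe
      (span_fourier_closure_eq_top (T := 1)) hf hε
    have h2 : char₁ = fun n (θ : ℝ) => fourier n (θ : UnitAddCircle) := by
      funext n θ; exact char₁_eq_fourier n θ
    rwa [h2]

theorem isCharacterSystem_char₂ : IsCharacterSystem vol₂ char₂ where
  measurable m := by unfold char₂; fun_prop
  norm_eq_one m p := by rw [char₂_eq, norm_mul, norm_char₁, norm_char₁, one_mul]
  sub m n p := by
    simp only [char₂_eq, map_mul, Prod.fst_sub, Prod.snd_sub, char₁_sub,
      show -(m.2 - n.2) = -m.2 - -n.2 by ring]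
    ring
  integral_eq_zero m hm := by
    simp only [char₂_eq]
    rw [vol₂_eq, integral_prod_mul (char₁ m.1) (char₁ (-m.2)), integral_char₁, integral_char₁]
    by_cases h : m.1 = 0
    · have h2 : -m.2 ≠ 0 := fun h2 => hm (Prod.ext h (neg_eq_zero.1 h2))
      rw [if_neg h2, mul_zero]
    · rw [if_neg h, zero_mul]
  dense f hf ε hε := by
    have hπ : Measurable fun p : ℝ × ℝ =>
        (![(p.1 : UnitAddCircle), (p.2 : UnitAddCircle)] : UnitAddTorus (Fin 2)) := by
      refine measurable_pi_lambda _ fun i => ?_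
      fin_cases i
      · exact AddCircle.measurable_mk'.comp measurable_fst
      · exact AddCircle.measurable_mk'.comp measurable_snd
    have hσ : Measurable fun y : UnitAddTorus (Fin 2) => (circleRep (y 0), circleRep (y 1)) :=
      (measurable_circleRep.comp (measurable_pi_apply 0)).prodMk
        (measurable_circleRep.comp (measurable_pi_apply 1))
    have hσπ : ∀ᵐ p ∂vol₂, (circleRep (p.1 : UnitAddCircle), circleRep (p.2 : UnitAddCircle)) =
        p := by
      rw [vol₂_eq]
      filter_upwards [Measure.quasiMeasurePreserving_fst.ae circleRep_coe,
        Measure.quasiMeasurePreserving_snd.ae circleRep_coe] with p h1 h2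
      rw [h1, h2]
    have h := exists_mem_span_integral_sub_le hπ hσ hσπ
      (UnitAddTorus.span_mFourier_closure_eq_top (d := Fin 2)) hf hε
    have h2 : (Set.range fun (n : Fin 2 → ℤ) (p : ℝ × ℝ) => UnitAddTorus.mFourier n
        (![(p.1 : UnitAddCircle), (p.2 : UnitAddCircle)] : UnitAddTorus (Fin 2))) ⊆
        Set.range char₂ := by
      rintro _ ⟨n, rfl⟩
      refine ⟨(n 0, -n 1), ?_⟩
      funext p
      rw [char₂_eq, char₁_eq_fourier, char₁_eq_fourier, neg_neg]
      simp [UnitAddTorus.mFourier, Fin.prod_univ_two]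
    obtain ⟨P, hP, hPε⟩ := h
    exact ⟨P, Submodule.span_mono h2 hP, hPε⟩

end Systems

section Overlap

/-- The indices of a window. -/
def windowIndex (N : ℕ) (i : Fin N) : ℤ := (i : ℕ)

theorem windowIndex_injective (N : ℕ) : Function.Injective (windowIndex N) := fun i j h =>
  Fin.ext (by simpa [windowIndex] using h)

theorem card_overlap_windowIndex (N : ℕ) (m : ℤ) :
    (Finset.univ.filter fun p : Fin N × Fin N =>
      windowIndex N p.2 = m + windowIndex N p.1).card = ((N : ℤ) - |m|).toNat := by
  have h : (Finset.Ico (max 0 (-m)) (min N (N - m))).card = ((N : ℤ) - |m|).toNat := by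
    rw [Int.card_Ico]; congr 1; grind
  rw [← h]
  refine Finset.card_bij (fun p _ => windowIndex N p.1) ?_ ?_ ?_
  · rintro ⟨i, j⟩ hp
    have h1 : ((j : ℕ) : ℤ) = m + (i : ℕ) := (Finset.mem_filter.1 hp).2
    have := i.2
    have := j.2
    refine Finset.mem_Ico.2 ⟨max_le ?_ ?_, lt_min ?_ ?_⟩ <;> simp only [windowIndex] <;> omega
  · rintro ⟨i, j⟩ hp ⟨i', j'⟩ hp' heq
    simp only [Finset.mem_filter, Finset.mem_univ, true_and] at hp hp' heq
    refine Prod.ext (windowIndex_injective N heq) (windowIndex_injective N ?_)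
    simp only [hp, hp', heq]
  · intro z hz
    simp only [Finset.mem_Ico, max_le_iff, lt_min_iff] at hz
    refine ⟨(⟨z.toNat, by omega⟩, ⟨(m + z).toNat, by omega⟩), ?_, ?_⟩
    · refine Finset.mem_filter.2 ⟨Finset.mem_univ _, ?_⟩
      simp only [windowIndex]; omega
    · simp only [windowIndex]; omega

theorem tendsto_overlap_windowIndex (m : ℤ) :
    Tendsto (fun N => overlap (windowIndex N) m) atTop (𝓝 1) := by
  have h : Tendsto (fun N : ℕ => 1 - (|m| : ℝ) / N) atTop (𝓝 1) := by
    simpa using (tendsto_const_div_atTop_nhds_zero_nat (|m| : ℝ)).const_sub 1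
  refine h.congr' ?_
  filter_upwards [eventually_ge_atTop (m.natAbs + 1)] with N hN
  have hN0 : (N : ℝ) ≠ 0 := by
    have : N ≠ 0 := by omega
    exact_mod_cast this
  have h1 : ((((N : ℤ) - |m|).toNat : ℕ) : ℝ) = N - |(m : ℝ)| := by
    have : ((((N : ℤ) - |m|).toNat : ℕ) : ℤ) = N - |m| := by
      rw [Int.toNat_of_nonneg]; rw [Int.abs_eq_natAbs]; omega
    exact_mod_cast congrArg (Int.cast : ℤ → ℝ) this
  rw [overlap, card_overlap_windowIndex, h1, Fintype.card_fin, sub_div, div_self hN0]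

theorem overlap_prodMap {G H ι κ : Type*} [AddCommGroup G] [AddCommGroup H] [DecidableEq G]
    [DecidableEq H] [Fintype ι] [Fintype κ] (g : ι → G) (h : κ → H) (m : G × H) :
    overlap (Prod.map g h) m = overlap g m.1 * overlap h m.2 := by
  unfold overlap
  rw [div_mul_div_comm, Fintype.card_prod, ← Nat.cast_mul, ← Nat.cast_mul, ← Finset.card_product]
  congr 2
  refine Finset.card_equiv (Equiv.prodProdProdComm ι κ ι κ) fun p => ?_
  simp [Prod.ext_iff]

end Overlap

section Covariance

variable {G Ω ι : Type*} [AddCommGroup G] [MeasurableSpace Ω] {μ : Measure Ω} [Fintype ι]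

theorem integrable_mul_conj {u v : Ω → ℂ} (hu : MemLp u 2 μ) (hv : MemLp v 2 μ) :
    Integrable (fun ω => u ω * conj (v ω)) μ :=
  hu.integrable_mul hv.star

theorem isHermitian_covMatrix (v : ι → Ω → ℂ) : (covMatrix μ v).IsHermitian := by
  ext i j
  simp only [covMatrix, Matrix.conjTranspose_apply, Matrix.of_apply, RCLike.star_def]
  rw [← integral_conj]
  simp only [map_mul, Complex.conj_conj, mul_comm]

theorem posSemidef_covMatrix {v : ι → Ω → ℂ} (hv : ∀ i, MemLp (v i) 2 μ) :
    (covMatrix μ v).PosSemidef := by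
  refine Matrix.posSemidef_iff_dotProduct_mulVec.2 ⟨isHermitian_covMatrix v, fun u => ?_⟩
  have hi : ∀ i j, Integrable (fun ω => conj (u i) * u j * (v i ω * conj (v j ω))) μ :=
    fun i j => (integrable_mul_conj (hv i) (hv j)).const_mul _
  have h : star u ⬝ᵥ covMatrix μ v *ᵥ u = ((∫ ω, ‖∑ i, conj (u i) * v i ω‖ ^ 2 ∂μ : ℝ) : ℂ) := by
    calc star u ⬝ᵥ covMatrix μ v *ᵥ u
        = ∑ i, ∑ j, ∫ ω, conj (u i) * u j * (v i ω * conj (v j ω)) ∂μ := by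
          simp only [dotProduct, Matrix.mulVec, Finset.mul_sum, Pi.star_apply, RCLike.star_def,
            covMatrix, Matrix.of_apply, integral_const_mul]
          exact Finset.sum_congr rfl fun i _ => Finset.sum_congr rfl fun j _ => by ring
      _ = ∫ ω, ∑ i, ∑ j, conj (u i) * u j * (v i ω * conj (v j ω)) ∂μ := by
          rw [integral_finsetSum _ fun i _ => integrable_finsetSum _ fun j _ => hi i j]
          exact Finset.sum_congr rfl fun i _ => (integral_finsetSum _ fun j _ => hi i j).symm
      _ = _ := by
          rw [← integral_complex_ofReal]
          refine integral_congr_ae (ae_of_all _ fun ω => ?_)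
          simp only
          rw [← Complex.normSq_eq_norm_sq, ← Complex.mul_conj, map_sum, Finset.sum_mul_sum]
          refine Finset.sum_congr rfl fun i _ => Finset.sum_congr rfl fun j _ => ?_
          rw [map_mul, Complex.conj_conj]; ring
  rw [h]
  exact_mod_cast integral_nonneg fun ω => by positivity

theorem IsStationary.covMatrix_eq {X : G → Ω → ℂ} (hX : IsStationary μ X) (g : ι → G) :
    covMatrix μ (fun i => X (g i)) = toeplitz (corr μ X) g := by
  ext i j
  simp only [covMatrix, toeplitz, Matrix.of_apply]
  rw [← hX.corr_eq _ (g j), add_sub_cancel]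

theorem BinaryVec.norm_le_one (x : BinaryVec ι) (i : ι) : ‖x.1 i‖ ≤ 1 := by
  rcases x.2.1 i with h | h <;> simp [h]

instance [Nonempty ι] : Nonempty (BinaryVec ι) :=
  ⟨⟨ones ι, fun _ => Or.inr rfl, fun h => by
    obtain ⟨i⟩ := ‹Nonempty ι›
    exact one_ne_zero (α := ℂ) (congrArg (fun x : EuclideanSpace ℂ ι => x i) h)⟩⟩

end Covariance

theorem intervalIntegral_eq_vol₁ {E : Type*} [NormedAddCommGroup E] [NormedSpace ℝ E]
    (f : ℝ → E) : ∫ θ in (-(1 / 2) : ℝ)..(1 / 2), f θ = ∫ θ, f θ ∂vol₁ := by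
  rw [intervalIntegral.integral_of_le (by norm_num), ← integral_Icc_eq_integral_Ioc]

theorem intervalIntegrable_iff_vol₁ {f : ℝ → ℝ} :
    IntervalIntegrable f volume (-(1 / 2)) (1 / 2) ↔ Integrable f vol₁ := by
  rw [intervalIntegrable_iff_integrableOn_Icc_of_le (by norm_num), IntegrableOn]

theorem intervalIntegral_eq_vol₂ {f : ℝ → ℝ → ℝ}
    (hf : Integrable (fun p : ℝ × ℝ => f p.1 p.2) vol₂) :
    ∫ φ in (-(1 / 2) : ℝ)..(1 / 2), ∫ θ in (-(1 / 2) : ℝ)..(1 / 2), f θ φ =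
      ∫ p, f p.1 p.2 ∂vol₂ := by
  simp only [intervalIntegral_eq_vol₁]
  rw [vol₂_eq] at hf ⊢
  exact (integral_prod_symm _ hf).symm

theorem IsSpectralDensity.eq_integral {r : ℤ → ℂ} {S : ℝ → ℝ} (h : IsSpectralDensity r S)
    (n : ℤ) : r n = ∫ θ, (S θ : ℂ) * char₁ n θ ∂vol₁ := by
  rw [h.coeff, intervalIntegral_eq_vol₁]; rfl

theorem IsSpectralDensity₂.eq_integral {r : ℤ × ℤ → ℂ} {S : ℝ → ℝ → ℝ}
    (h : IsSpectralDensity₂ r S) (m : ℤ × ℤ) :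
    r m = ∫ p, (S p.1 p.2 : ℂ) * char₂ m p ∂vol₂ := h.coeff m.1 m.2

theorem IsStationary.covMatrix_window {Ω : Type*} [MeasurableSpace Ω] {μ : Measure Ω}
    {X : ℤ → Ω → ℂ} (hX : IsStationary μ X) (N : ℕ) :
    covMatrix μ (window X N) = toeplitz (corr μ X) (windowIndex N) :=
  hX.covMatrix_eq (windowIndex N)

theorem IsStationary.covMatrix_window₂ {Ω : Type*} [MeasurableSpace Ω] {μ : Measure Ω}
    {X : ℤ × ℤ → Ω → ℂ} (hX : IsStationary μ X) (N F : ℕ) :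
    covMatrix μ (window₂ X N F) =
      toeplitz (corr μ X) (Prod.map (windowIndex N) (windowIndex F)) :=
  hX.covMatrix_eq (Prod.map (windowIndex N) (windowIndex F))

/-- The lower bound for binary masks of the covariance matrix of a stationary process. -/
theorem IsStationary.normLogDet_bounds {G T ι Ω : Type*} [AddCommGroup G] [MeasurableSpace T]
    {ν : Measure T} [IsProbabilityMeasure ν] {χ : G → T → ℂ} [Fintype ι] [DecidableEq ι]
    [Nonempty ι] [MeasurableSpace Ω] {μ : Measure Ω} {X : G → Ω → ℂ} (hX : IsStationary μ X)
    (hχ : IsCharacterSystem ν χ) {S : T → ℝ} (hS : Integrable S ν) (hS0 : ∀ᵐ t ∂ν, 0 ≤ S t)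
    (hr : ∀ g, corr μ X g = ∫ t, (S t : ℂ) * χ g t ∂ν) {g : ι → G} (hg : Function.Injective g)
    {ρ : ℝ} (hρ : 0 < ρ) :
    (∀ x : BinaryVec ι, (maskedMatrix ρ (covMatrix μ fun i => X (g i)) x.1).PosDef ∧
      ∫ t, Real.log (1 + ρ * S t) ∂ν ≤ normLogDet ρ (covMatrix μ fun i => X (g i)) x.1) ∧
    ∫ t, Real.log (1 + ρ * S t) ∂ν ≤
      ⨅ x : BinaryVec ι, normLogDet ρ (covMatrix μ fun i => X (g i)) x.1 := by
  have h : ∀ x : BinaryVec ι, (maskedMatrix ρ (covMatrix μ fun i => X (g i)) x.1).PosDef ∧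
      ∫ t, Real.log (1 + ρ * S t) ∂ν ≤ normLogDet ρ (covMatrix μ fun i => X (g i)) x.1 := by
    intro x
    have hM := posDef_maskedMatrix (posSemidef_covMatrix fun i => hX.memLp (g i)) hρ.le x.1
    refine ⟨hM, ?_⟩
    rw [hX.covMatrix_eq] at hM ⊢
    exact hχ.integral_log_le_normLogDet hS hS0 hr hg hρ x.norm_le_one x.2.2 hM
  exact ⟨h, le_ciInf fun x => (h x).2⟩

theorem IsStationary.posSemidef_toeplitz {G ι Ω : Type*} [AddCommGroup G] [Fintype ι]
    [MeasurableSpace Ω] {μ : Measure Ω} {X : G → Ω → ℂ} (hX : IsStationary μ X) (g : ι → G) :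
    (toeplitz (corr μ X) g).PosSemidef := by
  rw [← hX.covMatrix_eq]
  exact posSemidef_covMatrix fun i => hX.memLp (g i)

end StationaryLogDet

end

theorem mainTheorem6 {Ω : Type*} [MeasurableSpace Ω] (μ : MeasureTheory.Measure Ω)
    [MeasureTheory.IsProbabilityMeasure μ] (ρ : ℝ) (hρ : 0 < ρ) :
    -- one-dimensional processes
    (∀ (X : ℤ → Ω → ℂ) (S : ℝ → ℝ),
      StationaryLogDet.IsStationary μ X →
      StationaryLogDet.IsSpectralDensity (StationaryLogDet.corr μ X) S →
      -- the integrand on the right-hand side is well defined and integrable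
      (∀ᵐ θ ∂(volume.restrict (Set.Icc (-(1 / 2) : ℝ) (1 / 2))), 0 ≤ S θ) ∧
      IntervalIntegrable (fun θ => Real.log (1 + ρ * S θ)) volume (-(1 / 2)) (1 / 2) ∧
      (∀ N : ℕ, 1 ≤ N →
        -- Hermitian Toeplitz covariance matrix
        (StationaryLogDet.covMatrix μ (StationaryLogDet.window X N)).IsHermitian ∧
        (∀ i j : Fin N, StationaryLogDet.covMatrix μ (StationaryLogDet.window X N) i j =
          StationaryLogDet.corr μ X (((i : ℕ) : ℤ) - ((j : ℕ) : ℤ))) ∧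
        -- the lower bound, for each vector and for the infimum
        (∀ x : StationaryLogDet.BinaryVec (Fin N),
          (StationaryLogDet.maskedMatrix ρ
            (StationaryLogDet.covMatrix μ (StationaryLogDet.window X N)) x.1).PosDef ∧
          ∫ θ in (-(1 / 2) : ℝ)..(1 / 2), Real.log (1 + ρ * S θ) ≤
            StationaryLogDet.normLogDet ρ
              (StationaryLogDet.covMatrix μ (StationaryLogDet.window X N)) x.1) ∧
        ∫ θ in (-(1 / 2) : ℝ)..(1 / 2), Real.log (1 + ρ * S θ) ≤
          ⨅ x : StationaryLogDet.BinaryVec (Fin N), StationaryLogDet.normLogDet ρ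
            (StationaryLogDet.covMatrix μ (StationaryLogDet.window X N)) x.1) ∧
      -- equality in the limit for the all-ones vector
      Tendsto (fun N : ℕ => StationaryLogDet.normLogDet ρ
          (StationaryLogDet.covMatrix μ (StationaryLogDet.window X N))
          (StationaryLogDet.ones (Fin N)))
        atTop (𝓝 (∫ θ in (-(1 / 2) : ℝ)..(1 / 2), Real.log (1 + ρ * S θ)))) ∧
    -- two-dimensional processes
    (∀ (X : ℤ × ℤ → Ω → ℂ) (S : ℝ → ℝ → ℝ),
      StationaryLogDet.IsStationary μ X →
      StationaryLogDet.IsSpectralDensity₂ (StationaryLogDet.corr μ X) S →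
      (∀ᵐ p : ℝ × ℝ ∂(volume.restrict StationaryLogDet.square), 0 ≤ S p.1 p.2) ∧
      IntegrableOn (fun p : ℝ × ℝ => Real.log (1 + ρ * S p.1 p.2)) StationaryLogDet.square ∧
      (∀ N F : ℕ, 1 ≤ N → 1 ≤ F →
        -- two-level Hermitian Toeplitz covariance matrix
        (StationaryLogDet.covMatrix μ (StationaryLogDet.window₂ X N F)).IsHermitian ∧
        (∀ (i j : Fin N) (a b : Fin F),
          StationaryLogDet.covMatrix μ (StationaryLogDet.window₂ X N F) (i, a) (j, b) =
            StationaryLogDet.corr μ X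
              (((i : ℕ) : ℤ) - ((j : ℕ) : ℤ), ((a : ℕ) : ℤ) - ((b : ℕ) : ℤ))) ∧
        (∀ x : StationaryLogDet.BinaryVec (Fin N × Fin F),
          (StationaryLogDet.maskedMatrix ρ
            (StationaryLogDet.covMatrix μ (StationaryLogDet.window₂ X N F)) x.1).PosDef ∧
          ∫ φ in (-(1 / 2) : ℝ)..(1 / 2), ∫ θ in (-(1 / 2) : ℝ)..(1 / 2),
              Real.log (1 + ρ * S θ φ) ≤
            StationaryLogDet.normLogDet ρ
              (StationaryLogDet.covMatrix μ (StationaryLogDet.window₂ X N F)) x.1) ∧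
        ∫ φ in (-(1 / 2) : ℝ)..(1 / 2), ∫ θ in (-(1 / 2) : ℝ)..(1 / 2),
            Real.log (1 + ρ * S θ φ) ≤
          ⨅ x : StationaryLogDet.BinaryVec (Fin N × Fin F), StationaryLogDet.normLogDet ρ
            (StationaryLogDet.covMatrix μ (StationaryLogDet.window₂ X N F)) x.1) ∧
      -- `N` and `F` tend to infinity independently of each other
      Tendsto (fun q : ℕ × ℕ => StationaryLogDet.normLogDet ρ
          (StationaryLogDet.covMatrix μ (StationaryLogDet.window₂ X q.1 q.2))
          (StationaryLogDet.ones (Fin q.1 × Fin q.2)))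
        (atTop ×ˢ atTop)
        (𝓝 (∫ φ in (-(1 / 2) : ℝ)..(1 / 2), ∫ θ in (-(1 / 2) : ℝ)..(1 / 2),
          Real.log (1 + ρ * S θ φ)))) := by
  refine ⟨fun X S hX hS => ?_, fun X S hX hS => ?_⟩
  · have hχ := StationaryLogDet.isCharacterSystem_char₁
    have hSi := StationaryLogDet.intervalIntegrable_iff_vol₁.1 hS.integrable
    have hr := hS.eq_integral
    have hg := StationaryLogDet.windowIndex_injective
    have ho := StationaryLogDet.tendsto_overlap_windowIndex
    have hK := fun N => hX.posSemidef_toeplitz (StationaryLogDet.windowIndex N)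
    have hS0 := hχ.ae_nonneg hg ho hSi hr hK
    rw [StationaryLogDet.intervalIntegral_eq_vol₁]
    refine ⟨hS0, StationaryLogDet.intervalIntegrable_iff_vol₁.2
      (StationaryLogDet.integrable_log_one_add hρ hSi hS0), fun N hN => ?_, ?_⟩
    · have : Nonempty (Fin N) := ⟨⟨0, hN⟩⟩
      refine ⟨StationaryLogDet.isHermitian_covMatrix _, fun i j => ?_,
        hX.normLogDet_bounds hχ hSi hS0 hr (hg N) hρ⟩
      rw [hX.covMatrix_window]; rfl
    · simp only [hX.covMatrix_window]
      refine hχ.tendsto_normLogDet_ones hg ?_ ho hSi hS0 hr hK hρ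
      filter_upwards [eventually_ge_atTop 1] with N hN
      exact ⟨⟨0, hN⟩⟩
  · have hχ := StationaryLogDet.isCharacterSystem_char₂
    have hSi : Integrable (fun p : ℝ × ℝ => S p.1 p.2) StationaryLogDet.vol₂ := hS.integrable
    have hr := hS.eq_integral
    have hg : ∀ q : ℕ × ℕ, Function.Injective (Prod.map (StationaryLogDet.windowIndex q.1)
        (StationaryLogDet.windowIndex q.2)) := fun q =>
      (StationaryLogDet.windowIndex_injective q.1).prodMap
        (StationaryLogDet.windowIndex_injective q.2)
    have ho : ∀ m : ℤ × ℤ, Tendsto (fun q : ℕ × ℕ => StationaryLogDet.overlap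
        (Prod.map (StationaryLogDet.windowIndex q.1) (StationaryLogDet.windowIndex q.2)) m)
        (atTop ×ˢ atTop) (𝓝 1) := by
      intro m
      simp only [StationaryLogDet.overlap_prodMap]
      simpa using ((StationaryLogDet.tendsto_overlap_windowIndex m.1).comp tendsto_fst).mul
        ((StationaryLogDet.tendsto_overlap_windowIndex m.2).comp tendsto_snd)
    have hK := fun q : ℕ × ℕ => hX.posSemidef_toeplitz
      (Prod.map (StationaryLogDet.windowIndex q.1) (StationaryLogDet.windowIndex q.2))
    have hS0 := hχ.ae_nonneg hg ho hSi hr hK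
    have hlog := StationaryLogDet.integrable_log_one_add hρ hSi hS0
    rw [StationaryLogDet.intervalIntegral_eq_vol₂ (f := fun θ φ => Real.log (1 + ρ * S θ φ)) hlog]
    refine ⟨hS0, hlog, fun N F hN hF => ?_, ?_⟩
    · have : Nonempty (Fin N) := ⟨⟨0, hN⟩⟩
      have : Nonempty (Fin F) := ⟨⟨0, hF⟩⟩
      refine ⟨StationaryLogDet.isHermitian_covMatrix _, fun i j a b => ?_,
        hX.normLogDet_bounds hχ hSi hS0 hr (hg (N, F)) hρ⟩
      rw [hX.covMatrix_window₂]; rfl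
    · simp only [hX.covMatrix_window₂]
      refine hχ.tendsto_normLogDet_ones hg ?_ ho hSi hS0 hr hK hρ
      filter_upwards [tendsto_fst.eventually (eventually_ge_atTop 1),
        tendsto_snd.eventually (eventually_ge_atTop 1)] with q h1 h2
      exact ⟨(⟨0, h1⟩, ⟨0, h2⟩)⟩
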